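/- Model. Fix $m\ge 0$ and, for $k=1,\dots,m$, a feature dimension $r_k$, a similarity function $w_k:\mathbb R^{r_k}\times\mathbb R^{r_k}\to\mathbb R$ and an effect function $g_k:\mathbb R^{r_k}\to\mathbb R$. Let $p=3m+2$. For each $n$ let the nodes $1,\dots,n$ carry non-random features $v_j=(v_{j1},\dots,v_{jm})$, $v_{jk}\in\mathbb R^{r_k}$ (which may depend on $n$), and put $N=n(n-1)/2$. For nodes $j_1<j_2$ and $d=(a,b)\in\{0,1\}^2$ let $s_{j_1j_2}(d)\in\mathbb R^p$ be the vector with entries $$ab,\quad a+b,\quad (a+b)\,w_k(v_{j_1k},v_{j_2k}),\quad a\,g_k(v_{j_1k})+b\,g_k(v_{j_2k}),\quad a\,g_k(v_{j_2k})+b\,g_k(v_{j_1k})\qquad(k=1,\dots,m),$$ and, for $\theta\in\mathbb R^p$, $f_{j_1j_2}(d,\theta)=\exp\{\theta^\top s_{j_1j_2}(d)\}\big/\sum_{d'\in\{0,1\}^2}\exp\{\theta^\top s_{j_1j_2}(d')\}$. The observed directed network without self-loops $X=(X_{j_1j_2})\in\{0,1\}^{n\times n}$ has the distribution $$P(X=x)=\frac{\exp\{\theta_0^\top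 s(x)\}}{\sum_{x'}\exp\{\theta_0^\top s(x')\}},\qquad s(x)=\sum_{j_1<j_2}s_{j_1j_2}(x_{j_1j_2},x_{j_2j_1}),$$ where $\theta_0$ is the true parameter. Let $\mathcal L(\theta)=\sum_{j_1<j_2}\log f_{j_1j_2}\big((X_{j_1j_2},X_{j_2j_1}),\theta\big)$. Estimator. Let $\Theta\subseteq\mathbb R^p$ contain $\theta_0$ in its interior, let $\lambda_N\ge 0$, let $\omega_1,\dots,\omega_p\ge 0$ be possibly random and data-dependent weights, and let $\hat\theta$ be a measurable minimizer over $\Theta$ of $Q(\theta)=-\mathcal L(\theta)+\lambda_N\sum_{k=1}^p\omega_k|\theta_k|$. Let $\mathcal A=\{k:\theta_{0,k}\ne 0\}$, $a_w=\max_{k\in\mathcal A}\lambda_N\omega_k$ (the largest penalty on a true nonzero coefficient; $0$ if $\mathcal A=\emptyset$) and $b_w=\min_{k\in\mathcal A^c}\lambda_N\omega_k$ (the smallest penalty on a true zero coefficient; $\infty$ if $\mathcal A^c=\emptyset$). Regularity conditions. (C1) The average Fisher information per dyad at $\theta_0$, $\frac1N\sum_{j_1<j_2}\sum_{d}f_{j_1j_2}(d,\theta_0)\,\nabla\log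 f_{j_1j_2}(d,\theta_0)\,\nabla\log f_{j_1j_2}(d,\theta_0)^\top$, converges as $n\to\infty$ to a positive definite matrix $I(\theta_0)$. (C2) There are a ball $B$ around $\theta_0$, a constant $C$ and, for every $n$ and every $j_1<j_2$, a number $M_{n,j_1j_2}$ that bounds the norm of the third derivative of $\theta\mapsto\log f_{j_1j_2}(d,\theta)$ for all $\theta\in B$ and all $d$, such that $\sum_{j_1<j_2}M_{n,j_1j_2}\le CN$ for all $n$. (Uniformly bounded values of $w_k$ and $g_k$ suffice for (C2).) Theorem (Oracle property). Assume (C1), (C2), $a_w/\sqrt N\to 0$ in probability and $b_w/\sqrt N\to\infty$ in probability, as $n\to\infty$. Then: (i) (Selection consistency) $P(\hat\theta_{\mathcal A^c}=0)\to 1$. (ii) (Asymptotic normality) $\sqrt N(\hat\theta_{\mathcal A}-\theta_{0\mathcal A})$ converges in distribution to $\mathcal N\big(0,I_{\mathcal A}(\theta_0)^{-1}\big)$, where $I_{\mathcal A}(\theta_0)$ is the submatrix of $I(\theta_0)$ with rows and columns in $\mathcal A$. -/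

import Mathlib

open MeasureTheory ProbabilityTheory Filter Topology
open scoped ENNReal NNReal

noncomputable section

namespace DirectedNetwork

/-- Feature vectors of one node: `m` groups, the `k`-th one of dimension `r k`. -/
abbrev NodeFeatures {m : ℕ} (r : Fin m → ℕ) : Type :=
  (k : Fin m) → EuclideanSpace ℝ (Fin (r k))

/-- The two functions of the nodal features that enter the model, group by group: a similarity
measure between the feature vectors of two nodes (homophily) and a real-valued summary of the
feature vector of one node (nodal effect). -/
structure FeatureMaps {m : ℕ} (r : Fin m → ℕ) where
  /-- similarity measure for the `k`-th group -/
  sim : (k : Fin m) → EuclideanSpace ℝ (Fin (r k)) → EuclideanSpace ℝ (Fin (r k)) → ℝ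
  /-- nodal effect function for the `k`-th group -/
  eff : (k : Fin m) → EuclideanSpace ℝ (Fin (r k)) → ℝ

/-- Coordinates of the parameter vector, `p = 3 m + 2` in number: reciprocity and density, then
the `m` homophily, the `m` out-edge and the `m` in-edge parameters. -/
abbrev ParamIdx (m : ℕ) : Type := Fin 2 ⊕ Fin m ⊕ Fin m ⊕ Fin m

/-- The parameter space `ℝ ^ p`. -/
abbrev Param (m : ℕ) : Type := EuclideanSpace ℝ (ParamIdx m)

/-- Directed binary networks on `n` nodes without self-loops, as adjacency matrices. -/
abbrev Network (n : ℕ) : Type := {x : Fin n → Fin n → Bool // ∀ j, x j j = false}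

/-- The numerical value, `0` or `1`, of an entry of the adjacency matrix. -/
def bit (b : Bool) : ℝ := if b then 1 else 0

/-- The dyads: pairs of nodes `j₁ < j₂`. -/
def dyads (n : ℕ) : Finset (Fin n × Fin n) := Finset.univ.filter fun q => q.1 < q.2

/-- Ordered pairs of distinct nodes. -/
def orderedPairs (n : ℕ) : Finset (Fin n × Fin n) := Finset.univ.filter fun q => q.1 ≠ q.2

/-- The number of dyads, `N = n (n - 1) / 2`. -/
def numDyads (n : ℕ) : ℕ := n.choose 2

section Model

variable {m : ℕ} {r : Fin m → ℕ} (F : FeatureMaps r)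

/-- The sufficient statistics `s (x, V)` of a network: number of mutual dyads, number of edges,
nodal homophily, out-edge effects, in-edge effects. -/
def networkStat {n : ℕ} (V : Fin n → NodeFeatures r) (x : Network n) : ParamIdx m → ℝ
  | Sum.inl 0 => ∑ q ∈ dyads n, bit (x.1 q.1 q.2) * bit (x.1 q.2 q.1)
  | Sum.inl 1 => ∑ q ∈ orderedPairs n, bit (x.1 q.1 q.2)
  | Sum.inr (Sum.inl k) =>
      ∑ q ∈ dyads n, (bit (x.1 q.1 q.2) + bit (x.1 q.2 q.1)) * F.sim k (V q.1 k) (V q.2 k)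
  | Sum.inr (Sum.inr (Sum.inl k)) =>
      ∑ q ∈ orderedPairs n, bit (x.1 q.1 q.2) * F.eff k (V q.1 k)
  | Sum.inr (Sum.inr (Sum.inr k)) =>
      ∑ q ∈ orderedPairs n, bit (x.1 q.1 q.2) * F.eff k (V q.2 k)

/-- The probability of the network `x` under the parameter `θ` given the nodal features `V`:
`exp (θᵀ s (x, V)) / z (θ; V)`, where `z` sums over all networks. -/
def networkProb {n : ℕ} (V : Fin n → NodeFeatures r) (θ : Param m) (x : Network n) : ℝ :=
  Real.exp (∑ i, θ i * networkStat F V x i) /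
    ∑ x' : Network n, Real.exp (∑ i, θ i * networkStat F V x' i)

/-- The contribution of the dyad of two nodes with features `u` (first node) and `v` (second node)
to the sufficient statistics, if the dyad is `d = (x_{j₁j₂}, x_{j₂j₁})`. -/
def dyadStat (u v : NodeFeatures r) (d : Bool × Bool) : ParamIdx m → ℝ
  | Sum.inl 0 => bit d.1 * bit d.2
  | Sum.inl 1 => bit d.1 + bit d.2
  | Sum.inr (Sum.inl k) => (bit d.1 + bit d.2) * F.sim k (u k) (v k)
  | Sum.inr (Sum.inr (Sum.inl k)) => bit d.1 * F.eff k (u k) + bit d.2 * F.eff k (v k)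
  | Sum.inr (Sum.inr (Sum.inr k)) => bit d.1 * F.eff k (v k) + bit d.2 * F.eff k (u k)

/-- The probability of the dyad configuration `d`: proportional to `T₁₁`, `T₁₀`, `T₀₁` and `1` for
`d = (1,1)`, `(1,0)`, `(0,1)` and `(0,0)`. -/
def dyadProb (u v : NodeFeatures r) (θ : Param m) (d : Bool × Bool) : ℝ :=
  Real.exp (∑ i, θ i * dyadStat F u v d i) /
    ∑ d' : Bool × Bool, Real.exp (∑ i, θ i * dyadStat F u v d' i)

/-- The log-likelihood of the network `x`, summed over its dyads. -/
def logLik {n : ℕ} (V : Fin n → NodeFeatures r) (x : Network n) (θ : Param m) : ℝ :=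
  ∑ q ∈ dyads n, Real.log (dyadProb F (V q.1) (V q.2) θ (x.1 q.1 q.2, x.1 q.2 q.1))

/-- The regularized objective `Q (θ) = - L (θ) + λ ∑ₖ wₖ |θₖ|`. -/
def objective {n : ℕ} (V : Fin n → NodeFeatures r) (lam : ℝ≥0) (w : ParamIdx m → ℝ≥0)
    (x : Network n) (θ : Param m) : ℝ :=
  -logLik F V x θ + lam * ∑ k, w k * |θ k|

/-- The `k`-th component of the score of one dyad, `∂ log f_d (θ) / ∂ θₖ`. -/
def dyadScore (u v : NodeFeatures r) (θ : Param m) (d : Bool × Bool) (k : ParamIdx m) : ℝ :=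
  fderiv ℝ (fun t : Param m => Real.log (dyadProb F u v t d)) θ (EuclideanSpace.single k 1)

/-- The Fisher information matrix of one dyad: the expected outer product of the score. -/
def dyadFisher (u v : NodeFeatures r) (θ : Param m) : Matrix (ParamIdx m) (ParamIdx m) ℝ :=
  Matrix.of fun k l =>
    ∑ d : Bool × Bool, dyadProb F u v θ d * (dyadScore F u v θ d k * dyadScore F u v θ d l)

/-- The average Fisher information per dyad of a network on `n` nodes. -/
def avgFisher {n : ℕ} (V : Fin n → NodeFeatures r) (θ : Param m) :
    Matrix (ParamIdx m) (ParamIdx m) ℝ :=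
  (numDyads n : ℝ)⁻¹ • ∑ q ∈ dyads n, dyadFisher F (V q.1) (V q.2) θ

/-- `I₀` is the asymptotic Fisher information per dyad at `θ₀`, and it is positive definite. -/
def InformationCondition (V : (n : ℕ) → Fin n → NodeFeatures r) (θ₀ : Param m)
    (I₀ : Matrix (ParamIdx m) (ParamIdx m) ℝ) : Prop :=
  Tendsto (fun n => avgFisher F (V n) θ₀) atTop (𝓝 I₀) ∧ I₀.PosDef

/-- On some ball around `θ₀` the third derivatives of the dyadic log-probabilities are dominated,
dyad by dyad, by constants whose average over the dyads stays bounded. -/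
def ThirdDerivativeCondition (V : (n : ℕ) → Fin n → NodeFeatures r) (θ₀ : Param m) : Prop :=
  ∃ ρ > (0 : ℝ), ∃ C : ℝ, ∃ M : (n : ℕ) → Fin n × Fin n → ℝ,
    (∀ n, ∀ q ∈ dyads n, ∀ θ ∈ Metric.ball θ₀ ρ, ∀ d : Bool × Bool,
      ‖iteratedFDeriv ℝ 3
        (fun t : Param m => Real.log (dyadProb F (V n q.1) (V n q.2) t d)) θ‖ ≤ M n q) ∧
    ∀ n, ∑ q ∈ dyads n, M n q ≤ C * numDyads n

end Model

section Penalty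

variable {m : ℕ}

/-- The set `𝒜` of the indices of the nonzero coefficients of `θ₀`. -/
def support (θ₀ : Param m) : Set (ParamIdx m) := {k | θ₀ k ≠ 0}

/-- `a_w = max {λ wₖ : k ∈ 𝒜}`, which is `0` if `𝒜` is empty. -/
def maxPenalty (θ₀ : Param m) (lam : ℝ≥0) (w : ParamIdx m → ℝ≥0) : ℝ≥0∞ :=
  ⨆ k ∈ support θ₀, ((lam * w k : ℝ≥0) : ℝ≥0∞)

/-- `b_w = min {λ wₖ : k ∈ 𝒜ᶜ}`, which is `∞` if `𝒜ᶜ` is empty. -/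
def minPenalty (θ₀ : Param m) (lam : ℝ≥0) (w : ParamIdx m → ℝ≥0) : ℝ≥0∞ :=
  ⨅ k ∈ (support θ₀)ᶜ, ((lam * w k : ℝ≥0) : ℝ≥0∞)

/-- The vector of the coordinates of `θ` with index in `𝒜`. -/
def restrict (A : Set (ParamIdx m)) (θ : Param m) : EuclideanSpace ℝ A :=
  WithLp.toLp 2 fun k : A => θ k

end Penalty

/-- Convergence to `0` in probability of nonnegative random variables that may live on different
probability spaces. -/
def TendstoZeroInProb {Ω : ℕ → Type*} [∀ n, MeasurableSpace (Ω n)] (P : (n : ℕ) → Measure (Ω n))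
    (Z : (n : ℕ) → Ω n → ℝ≥0∞) : Prop :=
  ∀ ε : ℝ≥0, 0 < ε → Tendsto (fun n => P n {ω | (ε : ℝ≥0∞) ≤ Z n ω}) atTop (𝓝 0)

/-- Convergence to `∞` in probability of nonnegative random variables that may live on different
probability spaces. -/
def TendstoTopInProb {Ω : ℕ → Type*} [∀ n, MeasurableSpace (Ω n)] (P : (n : ℕ) → Measure (Ω n))
    (Z : (n : ℕ) → Ω n → ℝ≥0∞) : Prop :=
  ∀ K : ℝ≥0, Tendsto (fun n => P n {ω | Z n ω ≤ (K : ℝ≥0∞)}) atTop (𝓝 0)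

end DirectedNetwork

end

/-!
The network model is an exponential family, so the log-likelihood is `θᵀ s(x) - K(θ)`, where the
log-partition function `K` is convex, deterministic, and a sum over the dyads
(`logPartition_networkStat`). With `u = √N (θ - θ₀)`, the objective minus its value at `θ₀` is

  `κₙ(u) - uᵀ Zₙ + ∑ₖ λ ωₖ (|θ₀ₖ + uₖ / √N| - |θ₀ₖ|)`,

where `Zₙ` is the score at `θ₀` divided by `√N` (`observedScore`) and `κₙ` is `K` in the variable
`u` minus its tangent at `θ₀` (`centredPot`); see `objective_sub`. A Taylor expansion along lines,
the convergence of the average Fisher information and the bound on the third derivatives give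
`κₙ(u) → uᵀ I₀ u / 2` uniformly on balls (`eventually_abs_centredPot_sub_le`). This one limit drives
both halves of the proof.

*The score.* In an exponential family `E exp (uᵀ Zₙ) = exp κₙ(u)`, so the moment generating functions
of the score converge to those of `N(0, I₀)`. By Curtiss' theorem, proved here in the Gaussian case
from Prokhorov's theorem (`tendsto_gaussianReal_of_tendsto_mgf`), the score is asymptotically normal,
and in particular bounded in probability. No Lindeberg condition has to be verified.

*The minimizer.* The rest is deterministic (`exists_minimizer_bounds`). On the event that `Zₙ` is
bounded, the penalties on the nonzero coefficients are small and those on the zero coefficients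
large, convexity confines the scaled estimation error to a fixed ball; there the smooth part is
Lipschitz, being convex and bounded on a larger ball, so that a penalty above the Lipschitz constant
forces the zero coefficients to be estimated by zero; and comparison with the minimizer of
`uᵀ I₀ u / 2 - uᵀ Zₙ` among the vectors supported in `𝒜`, namely `I_𝒜⁻¹ Zₙ,𝒜` (`supportedMin`), shows
that the scaled error is close to that minimizer. Hence it has the limit law
`N(0, I_𝒜⁻¹ I_𝒜 I_𝒜⁻¹) = N(0, I_𝒜⁻¹)`, by Lévy's continuity theorem.
-/

/-! ### Convergence of moment generating functions implies convergence in distribution -/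

lemma measureReal_norm_gt_le_mgf {μ : Measure ℝ} [IsProbabilityMeasure μ]
    (hμ : ∀ t : ℝ, Integrable (fun x => Real.exp (t * x)) μ) (a : ℝ) :
    μ.real {x | a < ‖x‖} ≤ Real.exp (-a) * (mgf id μ 1 + mgf id μ (-1)) := by
  have h1 := measure_ge_le_exp_mul_mgf (μ := μ) (X := id) (t := 1) a zero_le_one
    (by simpa using hμ 1)
  have h2 := measure_le_le_exp_mul_mgf (μ := μ) (X := id) (t := -1) (-a) (by norm_num)
    (by simpa using hμ (-1))
  have hsub : {x : ℝ | a < ‖x‖} ⊆ {x | a ≤ id x} ∪ {x | id x ≤ -a} := by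
    intro x hx
    rcases lt_abs.1 (show a < |x| from hx) with h | h
    · exact Or.inl h.le
    · exact Or.inr (show x ≤ -a by linarith)
  calc μ.real {x | a < ‖x‖} ≤ μ.real ({x | a ≤ id x} ∪ {x | id x ≤ -a}) := measureReal_mono hsub
    _ ≤ _ := measureReal_union_le _ _
    _ ≤ _ := add_le_add h1 h2
    _ = _ := by simp; ring

/-- A sequence of laws on `ℝ` whose moment generating functions are bounded at `1` and `-1` is
tight. -/
lemma isTightMeasureSet_of_mgf_le {μ : ℕ → ProbabilityMeasure ℝ} {B : ℝ}
    (hint : ∀ n, ∀ t : ℝ, Integrable (fun x => Real.exp (t * x)) (μ n : Measure ℝ))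
    (hB : ∀ n, mgf id (μ n : Measure ℝ) 1 + mgf id (μ n : Measure ℝ) (-1) ≤ B) :
    IsTightMeasureSet {(μ n : Measure ℝ) | n} := by
  refine isTightMeasureSet_of_tendsto_measure_norm_gt ?_
  have hlim : Tendsto (fun a : ℝ => ENNReal.ofReal (Real.exp (-a) * B)) atTop (𝓝 0) := by
    have : Tendsto (fun a : ℝ => Real.exp (-a) * B) atTop (𝓝 (0 * B)) :=
      (Real.tendsto_exp_neg_atTop_nhds_zero).mul_const B
    simpa using ENNReal.tendsto_ofReal this
  refine tendsto_of_tendsto_of_tendsto_of_le_of_le tendsto_const_nhds hlim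
    (fun _ => zero_le) fun a => ?_
  refine iSup₂_le ?_
  rintro _ ⟨n, rfl⟩
  rw [← ENNReal.ofReal_toReal (measure_ne_top (μ n : Measure ℝ) _)]
  refine ENNReal.ofReal_le_ofReal ((measureReal_norm_gt_le_mgf (hint n) a).trans ?_)
  gcongr
  exact hB n

/-- `e^{tx}` truncated at the level `K`. -/
noncomputable def truncExp (t K : ℝ) (hK : 0 ≤ K) : BoundedContinuousFunction ℝ ℝ :=
  BoundedContinuousFunction.ofNormedAddCommGroup (fun x => min (Real.exp (t * x)) K)
    (by fun_prop) K fun x => by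
      rw [Real.norm_of_nonneg (le_min (Real.exp_pos _).le hK)]
      exact min_le_right _ _

lemma exp_sub_truncExp_le {t K : ℝ} (hK : 0 < K) (x : ℝ) :
    Real.exp (t * x) - min (Real.exp (t * x)) K ≤ Real.exp (2 * t * x) / K := by
  have h : Real.exp (2 * t * x) = Real.exp (t * x) * Real.exp (t * x) := by
    rw [← Real.exp_add]; congr 1; ring
  rcases le_total (Real.exp (t * x)) K with h1 | h1
  · rw [min_eq_left h1, sub_self]; positivity
  · rw [min_eq_right h1, le_div_iff₀ hK, h]
    nlinarith [Real.exp_pos (t * x)]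

/-- The truncation error of the moment generating function, by the value at `2 t`. -/
lemma abs_integral_truncExp_sub_mgf_le {μ : Measure ℝ} [IsProbabilityMeasure μ]
    (hμ : ∀ t : ℝ, Integrable (fun x => Real.exp (t * x)) μ) (t : ℝ) {K : ℝ} (hK : 0 < K) :
    |∫ x, truncExp t K hK.le x ∂μ - mgf id μ t| ≤ mgf id μ (2 * t) / K := by
  have hi := (truncExp t K hK.le).integrable μ
  rw [abs_sub_comm, mgf, mgf]
  simp only [id]
  rw [← integral_sub (hμ t) hi, abs_of_nonneg, ← integral_div]
  · exact integral_mono ((hμ t).sub hi) ((hμ (2 * t)).div_const K) fun x =>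
      exp_sub_truncExp_le hK x
  · exact integral_nonneg fun x => sub_nonneg.2 (min_le_left _ _)

/-- The limit of laws with converging moment generating functions has the limit as its moment
generating function. -/
lemma integrable_and_mgf_of_tendsto {ι : Type*} {l : Filter ι} [l.NeBot]
    {μ : ι → ProbabilityMeasure ℝ} {ν : ProbabilityMeasure ℝ} {M : ℝ → ℝ}
    (hint : ∀ n, ∀ t : ℝ, Integrable (fun x => Real.exp (t * x)) (μ n : Measure ℝ))
    (hM : ∀ t, Tendsto (fun n => mgf id (μ n : Measure ℝ) t) l (𝓝 (M t)))
    (hν : Tendsto μ l (𝓝 ν)) (t : ℝ) :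
    Integrable (fun x => Real.exp (t * x)) (ν : Measure ℝ) ∧ mgf id (ν : Measure ℝ) t = M t := by
  rw [ProbabilityMeasure.tendsto_iff_forall_integral_tendsto] at hν
  have hbound : ∀ (K : ℝ) (hK : 0 < K),
      |∫ x, truncExp t K hK.le x ∂(ν : Measure ℝ) - M t| ≤ M (2 * t) / K := fun K hK =>
    le_of_tendsto_of_tendsto ((hν (truncExp t K hK.le)).sub (hM t)).abs
      ((hM (2 * t)).div_const K)
      (Eventually.of_forall fun n => abs_integral_truncExp_sub_mgf_le (hint n) t hK)
  have hk : ∀ k : ℕ, (0 : ℝ) < k + 1 := fun k => by positivity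
  have hlim : Tendsto (fun k : ℕ => ∫ x, truncExp t (k + 1) (hk k).le x ∂(ν : Measure ℝ)) atTop
      (𝓝 (M t)) := by
    rw [tendsto_iff_dist_tendsto_zero]
    refine squeeze_zero (fun _ => dist_nonneg) (fun k => hbound _ (hk k)) ?_
    have := (tendsto_one_div_add_atTop_nhds_zero_nat (𝕜 := ℝ)).const_mul (M (2 * t))
    simpa [div_eq_mul_inv] using this
  have hmono : ∀ x : ℝ, Monotone fun k : ℕ => truncExp t (k + 1) (hk k).le x := by
    intro x i j hij
    refine min_le_min_left _ ?_
    gcongr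
  have hpt : ∀ x : ℝ, Tendsto (fun k : ℕ => truncExp t (k + 1) (hk k).le x) atTop
      (𝓝 (Real.exp (t * x))) := by
    intro x
    refine tendsto_const_nhds.congr' ?_
    filter_upwards [eventually_ge_atTop ⌈Real.exp (t * x)⌉₊] with k hk'
    have : Real.exp (t * x) ≤ k := Nat.ceil_le.1 hk'
    exact (min_eq_left (by linarith)).symm
  have hi : Integrable (fun x => Real.exp (t * x)) (ν : Measure ℝ) := by
    refine integrable_of_tendsto (Eventually.of_forall hpt)
      (fun k => (truncExp t (k + 1) (hk k).le).continuous.aestronglyMeasurable) ?_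
    have heq : ∀ k : ℕ, ∫⁻ x, ‖truncExp t (k + 1) (hk k).le x‖ₑ ∂(ν : Measure ℝ) =
        ENNReal.ofReal (∫ x, truncExp t (k + 1) (hk k).le x ∂(ν : Measure ℝ)) := fun k => by
      rw [ofReal_integral_eq_lintegral_ofReal ((truncExp t (k + 1) (hk k).le).integrable _)
        (Eventually.of_forall fun x => le_min (Real.exp_pos _).le (hk k).le)]
      exact lintegral_congr fun x =>
        Real.enorm_of_nonneg (le_min (Real.exp_pos _).le (hk k).le)
    simp_rw [heq]
    rw [(ENNReal.tendsto_ofReal hlim).liminf_eq]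
    exact ENNReal.ofReal_ne_top
  refine ⟨hi, ?_⟩
  exact tendsto_nhds_unique (integral_tendsto_of_tendsto_of_monotone
    (fun k => (truncExp t (k + 1) (hk k).le).integrable _) hi
    (Eventually.of_forall hmono) (Eventually.of_forall hpt)) hlim

/-- **Curtiss' theorem**, Gaussian case: if the moment generating functions converge pointwise to
the one of a centred Gaussian, then the laws converge weakly to it. -/
theorem tendsto_gaussianReal_of_tendsto_mgf {μ : ℕ → ProbabilityMeasure ℝ} {v : ℝ≥0}
    (hint : ∀ n, ∀ t : ℝ, Integrable (fun x => Real.exp (t * x)) (μ n : Measure ℝ))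
    (h : ∀ t : ℝ, Tendsto (fun n => mgf id (μ n : Measure ℝ) t) atTop
      (𝓝 (Real.exp (v * t ^ 2 / 2)))) :
    Tendsto μ atTop (𝓝 ⟨gaussianReal 0 v, inferInstance⟩) := by
  obtain ⟨B, hB⟩ := ((h 1).add (h (-1))).bddAbove_range
  have htight : IsTightMeasureSet {(μ n : Measure ℝ) | n} :=
    isTightMeasureSet_of_mgf_le hint fun n => hB ⟨n, rfl⟩
  have hcomp : IsCompact (closure {μ n | n}) :=
    isCompact_closure_of_isTightMeasureSet (by simpa using htight)
  -- By compactness it suffices to identify the limit along every ultrafilter.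
  refine (Filter.tendsto_iff_ultrafilter _ _ _).2 fun U hU => ?_
  obtain ⟨ν, -, hν : Tendsto μ U (𝓝 ν)⟩ := hcomp.ultrafilter_le_nhds (U.map μ)
    (.trans (by simp) (monotone_principal subset_closure))
  have key := fun t => integrable_and_mgf_of_tendsto hint (fun t => (h t).comp hU) hν t
  have hset : integrableExpSet id (ν : Measure ℝ) = Set.univ :=
    Set.eq_univ_of_forall fun t => (key t).1
  have heq : (ν : Measure ℝ) = gaussianReal 0 v := by
    refine Measure.ext_of_complexMGF_id_eq ?_
    ext z
    refine eqOn_complexMGF_of_mgf ?_ (by simp [hset])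
    ext t
    rw [(key t).2, mgf_id_gaussianReal]
    simp
  have : ν = ⟨gaussianReal 0 v, inferInstance⟩ := Subtype.ext heq
  rwa [← this]

/-! ### Log-partition functions of finite exponential families -/

section ExpFamily

variable {ι κ : Type*} [Fintype ι] [Fintype κ]

/-- The log-partition function `θ ↦ log ∑ d, exp (θᵀ s d)` of the exponential family on the finite
type `ι` with sufficient statistic `s`. -/
noncomputable def logPartition (s : ι → κ → ℝ) (θ : EuclideanSpace ℝ κ) : ℝ :=
  Real.log (∑ d, Real.exp (∑ i, θ i * s d i))

/-- The probability of `d` in the exponential family with sufficient statistic `s`. -/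
noncomputable def gibbs (s : ι → κ → ℝ) (θ : EuclideanSpace ℝ κ) (d : ι) : ℝ :=
  Real.exp (∑ i, θ i * s d i) / ∑ d', Real.exp (∑ i, θ i * s d' i)

/-- The mean of `hᵀ s` under the parameter `θ`. -/
noncomputable def gibbsMean (s : ι → κ → ℝ) (θ h : EuclideanSpace ℝ κ) : ℝ :=
  ∑ d, gibbs s θ d * ∑ i, h i * s d i

/-- The variance of `hᵀ s` under the parameter `θ`. -/
noncomputable def gibbsVar (s : ι → κ → ℝ) (θ h : EuclideanSpace ℝ κ) : ℝ :=
  ∑ d, gibbs s θ d * (∑ i, h i * s d i - gibbsMean s θ h) ^ 2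

variable (s : ι → κ → ℝ)

lemma gibbs_nonneg (θ : EuclideanSpace ℝ κ) (d : ι) : 0 ≤ gibbs s θ d :=
  div_nonneg (Real.exp_pos _).le (Finset.sum_nonneg fun _ _ => (Real.exp_pos _).le)

lemma gibbsMean_smul (θ h : EuclideanSpace ℝ κ) (c : ℝ) :
    gibbsMean s θ (c • h) = c * gibbsMean s θ h := by
  simp only [gibbsMean, Finset.mul_sum, PiLp.smul_apply, smul_eq_mul]
  refine Finset.sum_congr rfl fun d _ => Finset.sum_congr rfl fun i _ => by ring

omit [Fintype ι] in
lemma sum_add_smul_mul (θ h : EuclideanSpace ℝ κ) (t : ℝ) (d : ι) :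
    ∑ i, (θ + t • h) i * s d i = ∑ i, θ i * s d i + t * ∑ i, h i * s d i := by
  simp only [PiLp.add_apply, PiLp.smul_apply, smul_eq_mul, add_mul, Finset.sum_add_distrib,
    Finset.mul_sum, mul_assoc]

omit [Fintype ι] in
lemma hasDerivAt_exp_line (θ h : EuclideanSpace ℝ κ) (t : ℝ) (d : ι) :
    HasDerivAt (fun t : ℝ => Real.exp (∑ i, (θ + t • h) i * s d i))
      (Real.exp (∑ i, (θ + t • h) i * s d i) * ∑ i, h i * s d i) t := by
  simp only [sum_add_smul_mul]
  have := ((hasDerivAt_id t).mul_const (∑ i, h i * s d i)).const_add (∑ i, θ i * s d i)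
  simpa using this.exp

variable [Nonempty ι]

lemma partition_pos (θ : EuclideanSpace ℝ κ) : 0 < ∑ d, Real.exp (∑ i, θ i * s d i) :=
  Finset.sum_pos (fun _ _ => Real.exp_pos _) Finset.univ_nonempty

lemma sum_gibbs (θ : EuclideanSpace ℝ κ) : ∑ d, gibbs s θ d = 1 := by
  simp only [gibbs, ← Finset.sum_div]
  exact div_self (partition_pos s θ).ne'

lemma exp_logPartition (θ : EuclideanSpace ℝ κ) :
    Real.exp (logPartition s θ) = ∑ d, Real.exp (∑ i, θ i * s d i) :=
  Real.exp_log (partition_pos s θ)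

lemma gibbs_eq_exp (θ : EuclideanSpace ℝ κ) (d : ι) :
    gibbs s θ d = Real.exp (∑ i, θ i * s d i - logPartition s θ) := by
  rw [Real.exp_sub, exp_logPartition, gibbs]

lemma log_gibbs (θ : EuclideanSpace ℝ κ) (d : ι) :
    Real.log (gibbs s θ d) = ∑ i, θ i * s d i - logPartition s θ := by
  rw [gibbs_eq_exp, Real.log_exp]

lemma contDiff_logPartition {n : WithTop ℕ∞} : ContDiff ℝ n (logPartition s) := by
  refine ContDiff.log ?_ fun θ => (partition_pos s θ).ne'
  fun_prop

/-- The moment generating function of the sufficient statistic. -/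
lemma sum_gibbs_mul_exp (θ h : EuclideanSpace ℝ κ) :
    ∑ d, gibbs s θ d * Real.exp (∑ i, h i * s d i) =
      Real.exp (logPartition s (θ + h) - logPartition s θ) := by
  rw [Real.exp_sub, exp_logPartition, exp_logPartition, Finset.sum_div]
  refine Finset.sum_congr rfl fun d _ => ?_
  rw [gibbs, div_mul_eq_mul_div, ← Real.exp_add, ← Finset.sum_add_distrib]
  simp [add_mul]

/-- Jensen's inequality: the log-partition function lies above its tangents. -/
lemma logPartition_add_ge (θ h : EuclideanSpace ℝ κ) :
    logPartition s θ + gibbsMean s θ h ≤ logPartition s (θ + h) := by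
  have key : Real.exp (gibbsMean s θ h) ≤ Real.exp (logPartition s (θ + h) - logPartition s θ) := by
    rw [← sum_gibbs_mul_exp]
    exact convexOn_exp.map_sum_le (fun d _ => gibbs_nonneg s θ d) (sum_gibbs s θ)
      (fun _ _ => Set.mem_univ _)
  linarith [Real.exp_le_exp.1 key]

lemma convexOn_logPartition : ConvexOn ℝ Set.univ (logPartition s) := by
  refine ⟨convex_univ, fun x _ y _ a b ha hb hab => ?_⟩
  have hx := logPartition_add_ge s (a • x + b • y) (b • (x - y))
  have hy := logPartition_add_ge s (a • x + b • y) (-(a • (x - y)))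
  have hx' : a • x + b • y + b • (x - y) = x := by
    have h1 : b = 1 - a := by linarith
    subst h1; module
  have hy' : a • x + b • y + -(a • (x - y)) = y := by
    have h1 : b = 1 - a := by linarith
    subst h1; module
  rw [hx', gibbsMean_smul] at hx
  rw [hy', ← neg_smul, gibbsMean_smul] at hy
  simp only [smul_eq_mul]
  have h1 := mul_le_mul_of_nonneg_left hx ha
  have h2 := mul_le_mul_of_nonneg_left hy hb
  have : b = 1 - a := by linarith
  subst this
  nlinarith

omit [Nonempty ι] in
lemma hasDerivAt_partition_line (θ h : EuclideanSpace ℝ κ) (t : ℝ) :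
    HasDerivAt (fun t : ℝ => ∑ d, Real.exp (∑ i, (θ + t • h) i * s d i))
      (∑ d, Real.exp (∑ i, (θ + t • h) i * s d i) * ∑ i, h i * s d i) t :=
  HasDerivAt.fun_sum fun d _ => hasDerivAt_exp_line s θ h t d

/-- The first derivative of the log-partition function along a line is the mean. -/
lemma hasDerivAt_logPartition_line (θ h : EuclideanSpace ℝ κ) (t : ℝ) :
    HasDerivAt (fun t : ℝ => logPartition s (θ + t • h)) (gibbsMean s (θ + t • h) h) t := by
  have := (hasDerivAt_partition_line s θ h t).log (partition_pos s _).ne'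
  refine this.congr_deriv ?_
  simp only [gibbsMean, gibbs, Finset.sum_div]
  exact Finset.sum_congr rfl fun d _ => by ring

/-- The second derivative of the log-partition function along a line is the variance. -/
lemma hasDerivAt_gibbsMean_line (θ h : EuclideanSpace ℝ κ) (t : ℝ) :
    HasDerivAt (fun t : ℝ => gibbsMean s (θ + t • h) h) (gibbsVar s (θ + t • h) h) t := by
  have hp : ∀ d, HasDerivAt (fun t : ℝ => gibbs s (θ + t • h) d)
      (gibbs s (θ + t • h) d * (∑ i, h i * s d i - gibbsMean s (θ + t • h) h)) t := fun d => by
    have h0 := (partition_pos s (θ + t • h)).ne'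
    have := (hasDerivAt_exp_line s θ h t d).div (hasDerivAt_partition_line s θ h t) h0
    refine this.congr_deriv ?_
    have hm : gibbsMean s (θ + t • h) h =
        (∑ d, Real.exp (∑ i, (θ + t • h) i * s d i) * ∑ i, h i * s d i) /
          ∑ d, Real.exp (∑ i, (θ + t • h) i * s d i) := by
      simp only [gibbsMean, gibbs, Finset.sum_div]
      exact Finset.sum_congr rfl fun d _ => by ring
    rw [hm, gibbs]
    field_simp
  have := HasDerivAt.fun_sum (u := Finset.univ) fun d _ => (hp d).mul_const (∑ i, h i * s d i)
  refine this.congr_deriv ?_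
  have hz : ∑ d, gibbs s (θ + t • h) d *
      (∑ i, h i * s d i - gibbsMean s (θ + t • h) h) = 0 := by
    simp only [mul_sub, Finset.sum_sub_distrib, ← Finset.sum_mul, sum_gibbs, one_mul]
    exact sub_self _
  rw [eq_comm, gibbsVar, ← sub_eq_zero, ← Finset.sum_sub_distrib]
  calc _ = -gibbsMean s (θ + t • h) h * ∑ d, gibbs s (θ + t • h) d *
      (∑ i, h i * s d i - gibbsMean s (θ + t • h) h) := by
        rw [Finset.mul_sum]; exact Finset.sum_congr rfl fun d _ => by ring
    _ = 0 := by rw [hz, mul_zero]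

lemma iteratedDeriv_comp_line {E : Type*} [NormedAddCommGroup E] [NormedSpace ℝ E] {f : E → ℝ}
    {n : ℕ} (hf : ContDiff ℝ n f) (θ h : E) (t : ℝ) :
    iteratedDeriv n (fun t : ℝ => f (θ + t • h)) t =
      iteratedFDeriv ℝ n f (θ + t • h) fun _ => h := by
  have hf' : ContDiff ℝ n (fun x => f (θ + x)) := hf.comp (contDiff_const.add contDiff_id)
  have := (ContinuousLinearMap.toSpanSingleton ℝ h).iteratedFDeriv_comp_right hf' t le_rfl
  rw [iteratedDeriv_eq_iteratedFDeriv]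
  change iteratedFDeriv ℝ n
    ((fun x => f (θ + x)) ∘ (ContinuousLinearMap.toSpanSingleton ℝ h)) t _ = _
  rw [this, iteratedFDeriv_comp_add_left]
  simp

/-- Second-order Taylor expansion of the log-partition function, with the remainder bounded by the
third derivative on the segment. -/
lemma abs_logPartition_taylor_le (θ h : EuclideanSpace ℝ κ) {M : ℝ}
    (hM : ∀ t ∈ Set.Icc (0 : ℝ) 1, ‖iteratedFDeriv ℝ 3 (logPartition s) (θ + t • h)‖ ≤ M) :
    |logPartition s (θ + h) - logPartition s θ - gibbsMean s θ h - gibbsVar s θ h / 2| ≤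
      M * ‖h‖ ^ 3 / 6 := by
  set φ : ℝ → ℝ := fun t => logPartition s (θ + t • h) with hφ
  have hφc : ∀ n : ℕ, ContDiff ℝ n φ := fun n =>
    (contDiff_logPartition s).comp (by fun_prop)
  obtain ⟨x, hx, hT⟩ := taylor_mean_remainder_lagrange_iteratedDeriv (f := φ) (n := 2)
    (zero_ne_one (α := ℝ)) (by exact_mod_cast (hφc 3).contDiffOn)
  have hd1 : deriv φ = fun t => gibbsMean s (θ + t • h) h :=
    funext fun t => (hasDerivAt_logPartition_line s θ h t).deriv
  have hd2 : iteratedDeriv 2 φ 0 = gibbsVar s θ h := by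
    rw [iteratedDeriv_succ, iteratedDeriv_one, hd1]
    simpa using (hasDerivAt_gibbsMean_line s θ h 0).deriv
  have hu := uniqueDiffOn_uIcc (zero_ne_one (α := ℝ))
  have hw : ∀ n : ℕ, iteratedDerivWithin n φ (Set.uIcc 0 1) 0 = iteratedDeriv n φ 0 := fun n =>
    iteratedDerivWithin_eq_iteratedDeriv hu (hφc n).contDiffAt (by simp)
  rw [taylorWithinEval_succ, taylorWithinEval_succ, taylor_within_zero_eval] at hT
  simp only [zero_add, hw, one_add_one_eq_two, hd2, iteratedDeriv_one, hd1] at hT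
  norm_num [Nat.factorial] at hT
  have h3 : |iteratedDeriv 3 φ x| ≤ M * ‖h‖ ^ 3 := by
    rw [hφ, iteratedDeriv_comp_line (contDiff_logPartition s (n := (3 : ℕ)))]
    refine (ContinuousMultilinearMap.le_opNorm
      (iteratedFDeriv ℝ 3 (logPartition s) (θ + x • h)) fun _ => h).trans ?_
    simp only [Finset.prod_const, Finset.card_univ, Fintype.card_fin]
    gcongr
    exact hM x ⟨by simpa using hx.1.le, by simpa using hx.2.le⟩
  have e : logPartition s (θ + h) - logPartition s θ - gibbsMean s θ h - gibbsVar s θ h / 2 =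
      iteratedDeriv 3 φ x / 6 := by
    rw [← hT]; simp [hφ]; ring
  rw [e, abs_div, abs_of_pos (by norm_num : (0:ℝ) < 6)]
  gcongr

end ExpFamily

namespace DirectedNetwork

open scoped Matrix

/-! ### The likelihood of a network as a product over its dyads -/

section Network

variable {m : ℕ} {r : Fin m → ℕ} (F : FeatureMaps r)

lemma sum_orderedPairs {n : ℕ} (f : Fin n × Fin n → ℝ) :
    ∑ q ∈ orderedPairs n, f q = ∑ q ∈ dyads n, (f q + f q.swap) := by
  have h : orderedPairs n = dyads n ∪ (dyads n).image Prod.swap := by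
    ext ⟨a, b⟩
    simp only [orderedPairs, dyads, Finset.mem_filter, Finset.mem_univ, true_and,
      Finset.mem_union, Finset.mem_image, Prod.exists, Prod.swap_prod_mk, Prod.mk.injEq]
    constructor
    · intro h
      rcases lt_or_gt_of_ne h with h | h
      · exact Or.inl h
      · exact Or.inr ⟨b, a, h, rfl, rfl⟩
    · rintro (h | ⟨x, y, h, rfl, rfl⟩)
      · exact h.ne
      · exact h.ne'
  have hd : Disjoint (dyads n) ((dyads n).image Prod.swap) := by
    rw [Finset.disjoint_left]
    rintro ⟨a, b⟩ h1 h2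
    simp only [dyads, Finset.mem_filter, Finset.mem_univ, true_and, Finset.mem_image, Prod.exists,
      Prod.swap_prod_mk, Prod.mk.injEq] at h1 h2
    obtain ⟨x, y, h, rfl, rfl⟩ := h2
    exact lt_asymm h1 h
  rw [h, Finset.sum_union hd, Finset.sum_image (Prod.swap_injective.injOn),
    ← Finset.sum_add_distrib]

lemma networkStat_eq_sum {n : ℕ} (V : Fin n → NodeFeatures r) (x : Network n) (i : ParamIdx m) :
    networkStat F V x i =
      ∑ q ∈ dyads n, dyadStat F (V q.1) (V q.2) (x.1 q.1 q.2, x.1 q.2 q.1) i := by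
  rcases i with i | i | i | i
  · fin_cases i
    · simp [networkStat, dyadStat]
    · simp [networkStat, dyadStat, sum_orderedPairs]
  · simp [networkStat, dyadStat]
  · simp [networkStat, dyadStat, sum_orderedPairs]
  · simp [networkStat, dyadStat, sum_orderedPairs]

lemma dyadStat_false_false (u v : NodeFeatures r) : dyadStat F u v (false, false) = 0 := by
  funext i
  rcases i with i | i | i | i
  · fin_cases i <;> simp [dyadStat, bit]
  all_goals simp [dyadStat, bit]

/-- A network is determined by its dyads, which are unrestricted. -/
def networkEquiv (n : ℕ) : Network n ≃ ({q // q ∈ dyads n} → Bool × Bool) where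
  toFun x q := (x.1 q.1.1 q.1.2, x.1 q.1.2 q.1.1)
  invFun f := ⟨fun i j =>
    if h : i < j then (f ⟨(i, j), by simpa [dyads] using h⟩).1
    else if h : j < i then (f ⟨(j, i), by simpa [dyads] using h⟩).2 else false, by simp⟩
  left_inv x := by
    ext i j
    rcases lt_trichotomy i j with h | h | h
    · simp [h]
    · subst h; simp [x.2 i]
    · simp [h, h.not_gt]
  right_inv f := by
    funext ⟨⟨i, j⟩, h⟩
    have h' : i < j := by simpa [dyads] using h
    simp [h', h'.not_gt]

/-- A sum over networks of a product over dyads factorizes. -/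
lemma sum_network_prod {n : ℕ} (g : Fin n × Fin n → Bool × Bool → ℝ) :
    ∑ x : Network n, ∏ q ∈ dyads n, g q (x.1 q.1 q.2, x.1 q.2 q.1) =
      ∏ q ∈ dyads n, ∑ d, g q d := by
  rw [← Finset.prod_attach (dyads n) fun q => ∑ d, g q d, ← Finset.univ_eq_attach,
    Finset.prod_univ_sum, Fintype.piFinset_univ]
  refine Fintype.sum_equiv (networkEquiv n) _ _ fun x => ?_
  rw [← Finset.prod_attach]
  rfl

instance {n : ℕ} : Nonempty (Network n) := ⟨⟨fun _ _ => false, fun _ => rfl⟩⟩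

lemma inner_networkStat {n : ℕ} (V : Fin n → NodeFeatures r) (θ : Param m) (x : Network n) :
    ∑ i, θ i * networkStat F V x i = ∑ q ∈ dyads n,
      ∑ i, θ i * dyadStat F (V q.1) (V q.2) (x.1 q.1 q.2, x.1 q.2 q.1) i := by
  simp only [networkStat_eq_sum, Finset.mul_sum]
  exact Finset.sum_comm

/-- Dyads are independent: the log-partition function of the network model is the sum of the
log-partition functions of its dyads. -/
lemma logPartition_networkStat {n : ℕ} (V : Fin n → NodeFeatures r) (θ : Param m) :
    logPartition (networkStat F V) θ =
      ∑ q ∈ dyads n, logPartition (dyadStat F (V q.1) (V q.2)) θ := by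
  simp only [logPartition, inner_networkStat, Real.exp_sum (dyads n)]
  rw [sum_network_prod fun q d => Real.exp (∑ i, θ i * dyadStat F (V q.1) (V q.2) d i),
    Real.log_prod fun q _ => (partition_pos _ θ).ne']

lemma logLik_eq {n : ℕ} (V : Fin n → NodeFeatures r) (x : Network n) (θ : Param m) :
    logLik F V x θ = ∑ i, θ i * networkStat F V x i -
      ∑ q ∈ dyads n, logPartition (dyadStat F (V q.1) (V q.2)) θ := by
  rw [inner_networkStat, ← Finset.sum_sub_distrib]
  exact Finset.sum_congr rfl fun q _ => log_gibbs _ θ _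

lemma gibbsMean_eq_sum_single {ι κ : Type*} [Fintype ι] [Fintype κ] [DecidableEq κ]
    (s : ι → κ → ℝ) (θ h : EuclideanSpace ℝ κ) :
    gibbsMean s θ h = ∑ i, h i * gibbsMean s θ (EuclideanSpace.single i 1) := by
  simp only [gibbsMean, Finset.mul_sum, PiLp.single_apply]
  rw [Finset.sum_comm]
  refine Finset.sum_congr rfl fun i _ => Finset.sum_congr rfl fun d _ => ?_
  simp; ring

/-- The score is the centred sufficient statistic. -/
lemma dyadScore_eq (u v : NodeFeatures r) (θ : Param m) (d : Bool × Bool) (k : ParamIdx m) :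
    dyadScore F u v θ d k =
      dyadStat F u v d k - gibbsMean (dyadStat F u v) θ (EuclideanSpace.single k 1) := by
  have hfun : (fun t : Param m => Real.log (dyadProb F u v t d)) =
      fun t => ∑ i, t i * dyadStat F u v d i - logPartition (dyadStat F u v) t :=
    funext fun t => log_gibbs _ t d
  have hdiff : DifferentiableAt ℝ
      (fun t : Param m => ∑ i, t i * dyadStat F u v d i - logPartition (dyadStat F u v) t) θ := by
    refine DifferentiableAt.sub (by fun_prop) ?_
    exact ((contDiff_logPartition (n := 1) _).differentiable one_ne_zero) θ
  rw [dyadScore, hfun, ← hdiff.lineDeriv_eq_fderiv, lineDeriv]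
  have h1 : HasDerivAt (fun t : ℝ => ∑ i, (θ + t • EuclideanSpace.single k (1 : ℝ)) i *
      dyadStat F u v d i) (dyadStat F u v d k) 0 := by
    simp only [sum_add_smul_mul]
    have := ((hasDerivAt_id (0 : ℝ)).mul_const (dyadStat F u v d k)).const_add
      (∑ i, θ i * dyadStat F u v d i)
    simpa using this
  have h2 := hasDerivAt_logPartition_line (dyadStat F u v) θ (EuclideanSpace.single k (1 : ℝ)) 0
  rw [zero_smul, add_zero] at h2
  exact (h1.sub h2).deriv

/-- The Fisher information of a dyad is the covariance matrix of its sufficient statistic. -/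
lemma dotProduct_dyadFisher (u v : NodeFeatures r) (θ h : Param m) :
    h.ofLp ⬝ᵥ dyadFisher F u v θ *ᵥ h.ofLp = gibbsVar (dyadStat F u v) θ h := by
  have hs : ∀ d, ∑ i, h i * dyadStat F u v d i - gibbsMean (dyadStat F u v) θ h =
      ∑ k, h k * dyadScore F u v θ d k := fun d => by
    rw [gibbsMean_eq_sum_single, ← Finset.sum_sub_distrib]
    exact Finset.sum_congr rfl fun k _ => by rw [dyadScore_eq]; ring
  simp only [gibbsVar, hs, dotProduct, Matrix.mulVec, dyadFisher, Matrix.of_apply, sq,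
    Finset.sum_mul, Finset.mul_sum]
  rw [Finset.sum_congr rfl fun k _ => Finset.sum_comm, Finset.sum_comm]
  refine Finset.sum_congr rfl fun d _ => ?_
  rw [Finset.sum_comm]
  refine Finset.sum_congr rfl fun k _ => Finset.sum_congr rfl fun l _ => ?_
  change _ = gibbs _ _ _ * _
  rw [show dyadProb F u v θ d = gibbs (dyadStat F u v) θ d from rfl]
  ring

end Network

/-! ### The likelihood on the scale of the estimation error -/

section Local

variable {m : ℕ} {r : Fin m → ℕ} (F : FeatureMaps r)

/-- The log-partition function of the network model around `θ₀` at the scale `τ`, minus its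
tangent at `θ₀`. -/
noncomputable def centredPot {n : ℕ} (V : Fin n → NodeFeatures r) (θ₀ : Param m) (τ : ℝ)
    (u : Param m) : ℝ :=
  ∑ q ∈ dyads n, (logPartition (dyadStat F (V q.1) (V q.2)) (θ₀ + τ • u) -
    logPartition (dyadStat F (V q.1) (V q.2)) θ₀ -
    gibbsMean (dyadStat F (V q.1) (V q.2)) θ₀ (τ • u))

/-- The score of the network model at `θ₀`, multiplied by `τ`. -/
noncomputable def scaledScore {n : ℕ} (V : Fin n → NodeFeatures r) (θ₀ : Param m) (τ : ℝ)
    (x : Network n) : Param m :=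
  WithLp.toLp 2 fun i => τ * (networkStat F V x i -
    ∑ q ∈ dyads n, gibbsMean (dyadStat F (V q.1) (V q.2)) θ₀ (EuclideanSpace.single i 1))

variable {n : ℕ} (V : Fin n → NodeFeatures r) (θ₀ : Param m) (τ : ℝ)

/-- The centring constant of the score, assembled from the dyad means, is the tangent term of
`centredPot`. -/
lemma inner_scaledScore (u : Param m) (x : Network n) :
    inner ℝ u (scaledScore F V θ₀ τ x) = ∑ i, (τ • u) i * networkStat F V x i -
      ∑ q ∈ dyads n, gibbsMean (dyadStat F (V q.1) (V q.2)) θ₀ (τ • u) := by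
  have h : ∑ q ∈ dyads n, gibbsMean (dyadStat F (V q.1) (V q.2)) θ₀ (τ • u) =
      ∑ i, (τ • u) i * ∑ q ∈ dyads n,
        gibbsMean (dyadStat F (V q.1) (V q.2)) θ₀ (EuclideanSpace.single i 1) := by
    simp only [Finset.mul_sum]
    rw [Finset.sum_comm]
    exact Finset.sum_congr rfl fun q _ => gibbsMean_eq_sum_single _ _ _
  rw [h, ← Finset.sum_sub_distrib, PiLp.inner_apply]
  refine Finset.sum_congr rfl fun i _ => ?_
  simp [scaledScore]; ring

lemma logLik_sub (u : Param m) (x : Network n) :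
    logLik F V x (θ₀ + τ • u) - logLik F V x θ₀ =
      inner ℝ u (scaledScore F V θ₀ τ x) - centredPot F V θ₀ τ u := by
  rw [logLik_eq, logLik_eq, inner_scaledScore, sum_add_smul_mul, centredPot]
  simp only [Finset.sum_sub_distrib, PiLp.smul_apply, smul_eq_mul, mul_assoc, ← Finset.mul_sum]
  ring

/-- The moment generating function of the scaled score. -/
lemma sum_networkProb_mul_exp (u : Param m) :
    ∑ x : Network n, networkProb F V θ₀ x * Real.exp (inner ℝ u (scaledScore F V θ₀ τ x)) =
      Real.exp (centredPot F V θ₀ τ u) := by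
  have h := sum_gibbs_mul_exp (networkStat F V) θ₀ (τ • u)
  simp only [inner_scaledScore, Real.exp_sub _ (∑ q ∈ dyads n, _), ← mul_div_assoc,
    ← Finset.sum_div]
  rw [show ∑ x : Network n, networkProb F V θ₀ x *
    Real.exp (∑ i, (τ • u) i * networkStat F V x i) = _ from h, ← Real.exp_sub,
    logPartition_networkStat, logPartition_networkStat, centredPot]
  simp only [Finset.sum_sub_distrib]

lemma centredPot_zero : centredPot F V θ₀ τ 0 = 0 := by
  simp [centredPot, gibbsMean]

lemma convexOn_centredPot : ConvexOn ℝ Set.univ (centredPot F V θ₀ τ) := by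
  refine ⟨convex_univ, fun x _ y _ a b ha hb hab => ?_⟩
  simp only [centredPot, smul_eq_mul, Finset.mul_sum, ← Finset.sum_add_distrib]
  refine Finset.sum_le_sum fun q _ => ?_
  have h := (convexOn_logPartition (dyadStat F (V q.1) (V q.2))).2 (Set.mem_univ (θ₀ + τ • x))
    (Set.mem_univ (θ₀ + τ • y)) ha hb hab
  have e : a • (θ₀ + τ • x) + b • (θ₀ + τ • y) = θ₀ + τ • (a • x + b • y) := by
    have : b = 1 - a := by linarith
    subst this; module
  have e2 : gibbsMean (dyadStat F (V q.1) (V q.2)) θ₀ (τ • (a • x + b • y)) =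
      a * gibbsMean (dyadStat F (V q.1) (V q.2)) θ₀ (τ • x) +
      b * gibbsMean (dyadStat F (V q.1) (V q.2)) θ₀ (τ • y) := by
    rw [← gibbsMean_smul, ← gibbsMean_smul, gibbsMean_eq_sum_single,
      gibbsMean_eq_sum_single _ _ (a • τ • x), gibbsMean_eq_sum_single _ _ (b • τ • y),
      ← Finset.sum_add_distrib]
    refine Finset.sum_congr rfl fun i _ => ?_
    simp; ring
  rw [e, smul_eq_mul, smul_eq_mul] at h
  rw [e2]
  have : b = 1 - a := by linarith
  subst this
  linarith

lemma dotProduct_avgFisher (u : Param m) :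
    u.ofLp ⬝ᵥ avgFisher F V θ₀ *ᵥ u.ofLp =
      (numDyads n : ℝ)⁻¹ * ∑ q ∈ dyads n, gibbsVar (dyadStat F (V q.1) (V q.2)) θ₀ u := by
  rw [avgFisher, Matrix.smul_mulVec, dotProduct_smul, Matrix.sum_mulVec, dotProduct_sum,
    smul_eq_mul]
  simp only [dotProduct_dyadFisher]

lemma gibbsVar_smul {ι κ : Type*} [Fintype ι] [Fintype κ]
    (s : ι → κ → ℝ) (θ h : EuclideanSpace ℝ κ) (c : ℝ) :
    gibbsVar s θ (c • h) = c ^ 2 * gibbsVar s θ h := by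
  simp only [gibbsVar, gibbsMean_smul, PiLp.smul_apply, smul_eq_mul, mul_assoc, ← Finset.mul_sum,
    ← mul_sub, mul_pow]
  rw [Finset.mul_sum]
  exact Finset.sum_congr rfl fun _ _ => by ring

/-- The empty dyad has statistic `0`, so its log-probability is minus the log-partition function;
this turns bounds on log-probabilities into bounds on the log-partition function. -/
lemma norm_iteratedFDeriv_logPartition (u v : NodeFeatures r) (θ : Param m) (k : ℕ) :
    ‖iteratedFDeriv ℝ k (logPartition (dyadStat F u v)) θ‖ =
      ‖iteratedFDeriv ℝ k (fun t : Param m => Real.log (dyadProb F u v t (false, false))) θ‖ := by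
  have : (fun t : Param m => Real.log (dyadProb F u v t (false, false))) =
      -logPartition (dyadStat F u v) := funext fun t => by
    refine (log_gibbs _ t _).trans ?_
    simp [dyadStat_false_false]
  rw [this, iteratedFDeriv_neg_apply, norm_neg]

/-- Taylor expansion of the centred log-partition function at the scale `τ = N ^ (-1/2)`. -/
lemma abs_centredPot_sub_le {ρ C : ℝ} {M : Fin n × Fin n → ℝ}
    (hM : ∀ q ∈ dyads n, ∀ θ ∈ Metric.ball θ₀ ρ, ∀ d : Bool × Bool,
      ‖iteratedFDeriv ℝ 3
        (fun t : Param m => Real.log (dyadProb F (V q.1) (V q.2) t d)) θ‖ ≤ M q)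
    (hC : ∑ q ∈ dyads n, M q ≤ C * numDyads n) (hτ : 0 < τ) (hN : τ ^ 2 * numDyads n = 1)
    {u : Param m} (hu : τ * ‖u‖ < ρ) :
    |centredPot F V θ₀ τ u - u.ofLp ⬝ᵥ avgFisher F V θ₀ *ᵥ u.ofLp / 2| ≤
      C * τ * ‖u‖ ^ 3 / 6 := by
  have hinv : (numDyads n : ℝ)⁻¹ = τ ^ 2 := (eq_inv_of_mul_eq_one_left hN).symm
  rw [dotProduct_avgFisher, hinv, Finset.mul_sum, centredPot, Finset.sum_div,
    ← Finset.sum_sub_distrib]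
  calc _ ≤ ∑ q ∈ dyads n, M q * ‖τ • u‖ ^ 3 / 6 := by
        refine (Finset.abs_sum_le_sum_abs _ _).trans (Finset.sum_le_sum fun q hq => ?_)
        rw [← gibbsVar_smul]
        refine abs_logPartition_taylor_le _ θ₀ (τ • u) fun t ht => ?_
        rw [norm_iteratedFDeriv_logPartition]
        refine hM q hq _ ?_ _
        rw [Metric.mem_ball, dist_eq_norm, add_sub_cancel_left, norm_smul, norm_smul,
          Real.norm_of_nonneg ht.1, Real.norm_of_nonneg hτ.le]
        have h0 : 0 ≤ τ * ‖u‖ := by positivity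
        nlinarith [ht.2]
    _ = (∑ q ∈ dyads n, M q) * ((τ * ‖u‖) ^ 3 / 6) := by
        rw [Finset.sum_mul, norm_smul, Real.norm_of_nonneg hτ.le]
        exact Finset.sum_congr rfl fun _ _ => by ring
    _ ≤ C * numDyads n * ((τ * ‖u‖) ^ 3 / 6) := by gcongr
    _ = C * (τ ^ 2 * numDyads n) * τ * ‖u‖ ^ 3 / 6 := by ring
    _ = _ := by rw [hN, mul_one]

lemma abs_dotProduct_mulVec_le {κ : Type*} [Fintype κ] (D : Matrix κ κ ℝ)
    (u : EuclideanSpace ℝ κ) : |u.ofLp ⬝ᵥ D *ᵥ u.ofLp| ≤ (∑ k, ∑ l, |D k l|) * ‖u‖ ^ 2 := by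
  simp only [dotProduct, Matrix.mulVec, Finset.sum_mul, Finset.mul_sum]
  refine (Finset.abs_sum_le_sum_abs _ _).trans (Finset.sum_le_sum fun k _ => ?_)
  refine (Finset.abs_sum_le_sum_abs _ _).trans (Finset.sum_le_sum fun l _ => ?_)
  have h1 : |u k| ≤ ‖u‖ := PiLp.norm_apply_le u k
  have h2 : |u l| ≤ ‖u‖ := PiLp.norm_apply_le u l
  rw [abs_mul, abs_mul, sq]
  calc |u k| * (|D k l| * |u l|) = |D k l| * (|u k| * |u l|) := by ring
    _ ≤ |D k l| * (‖u‖ * ‖u‖) := by gcongr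

end Local

/-- The scale `N ^ (-1/2)` of the estimation error; it has the junk value `0` for networks without
dyads. -/
noncomputable def rate (n : ℕ) : ℝ := (Real.sqrt (numDyads n))⁻¹

lemma tendsto_numDyads : Tendsto (fun n => (numDyads n : ℝ)) atTop atTop := by
  refine tendsto_natCast_atTop_atTop.comp ?_
  refine tendsto_atTop_mono' _ ?_ (tendsto_sub_atTop_nat 1)
  filter_upwards [eventually_ge_atTop 2] with n hn
  rw [numDyads, Nat.choose_two_right, Nat.le_div_iff_mul_le two_pos, mul_comm]
  exact Nat.mul_le_mul_right _ hn

lemma tendsto_rate : Tendsto rate atTop (𝓝 0) :=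
  tendsto_inv_atTop_zero.comp (Real.tendsto_sqrt_atTop.comp tendsto_numDyads)

lemma eventually_rate : ∀ᶠ n in atTop, 0 < rate n ∧ rate n ^ 2 * numDyads n = 1 := by
  filter_upwards [tendsto_numDyads.eventually_gt_atTop 0] with n hn
  refine ⟨by rw [rate]; positivity, ?_⟩
  rw [rate, inv_pow, Real.sq_sqrt hn.le, inv_mul_cancel₀ hn.ne']

/-- The local log-partition function converges to the quadratic form of the information matrix,
uniformly on balls. -/
lemma eventually_abs_centredPot_sub_le {m : ℕ} {r : Fin m → ℕ} (F : FeatureMaps r)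
    (V : (n : ℕ) → Fin n → NodeFeatures r) (θ₀ : Param m)
    (I₀ : Matrix (ParamIdx m) (ParamIdx m) ℝ)
    (hI : Tendsto (fun n => avgFisher F (V n) θ₀) atTop (𝓝 I₀))
    (hT : ThirdDerivativeCondition F V θ₀) (R : ℝ) {ε : ℝ} (hε : 0 < ε) :
    ∀ᶠ n in atTop, ∀ u : Param m, ‖u‖ ≤ R →
      |centredPot F (V n) θ₀ (rate n) u - u.ofLp ⬝ᵥ I₀ *ᵥ u.ofLp / 2| ≤ ε := by
  obtain ⟨ρ, hρ, C, M, hM, hC⟩ := hT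
  have h1 : Tendsto (fun n => |C| * rate n * R ^ 3 / 6 +
      (∑ k, ∑ l, |(avgFisher F (V n) θ₀ - I₀) k l|) * R ^ 2 / 2) atTop
      (𝓝 (|C| * 0 * R ^ 3 / 6 + (∑ k : ParamIdx m, ∑ l : ParamIdx m, |(0 : ℝ)|) * R ^ 2 / 2)) := by
    refine Tendsto.add (((tendsto_rate.const_mul _).mul_const _).div_const _)
      (((tendsto_finsetSum _ fun k _ => tendsto_finsetSum _ fun l _ => ?_).mul_const _).div_const _)
    have := (hI.sub_const I₀)
    rw [sub_self] at this
    exact (tendsto_pi_nhds.1 (tendsto_pi_nhds.1 this k) l).abs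
  have h2 : Tendsto (fun n => rate n * R) atTop (𝓝 0) := by
    simpa using tendsto_rate.mul_const R
  simp only [mul_zero, zero_mul, zero_div, abs_zero, Finset.sum_const_zero, add_zero] at h1
  filter_upwards [h1.eventually_lt_const hε, h2.eventually_lt_const hρ, eventually_rate]
    with n hn1 hn2 ⟨hn3, hn4⟩ u hu
  have hR : 0 ≤ R := (norm_nonneg u).trans hu
  have ha := abs_centredPot_sub_le F (V n) θ₀ (rate n) (hM n) (hC n) hn3 hn4
    (u := u) (lt_of_le_of_lt (by gcongr) hn2)
  have hb := abs_dotProduct_mulVec_le (avgFisher F (V n) θ₀ - I₀) u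
  rw [Matrix.sub_mulVec, dotProduct_sub] at hb
  calc _ = |(centredPot F (V n) θ₀ (rate n) u - u.ofLp ⬝ᵥ avgFisher F (V n) θ₀ *ᵥ u.ofLp / 2) +
        (u.ofLp ⬝ᵥ avgFisher F (V n) θ₀ *ᵥ u.ofLp - u.ofLp ⬝ᵥ I₀ *ᵥ u.ofLp) / 2| := by
        congr 1; ring
    _ ≤ C * rate n * ‖u‖ ^ 3 / 6 +
        ((∑ k, ∑ l, |(avgFisher F (V n) θ₀ - I₀) k l|) * ‖u‖ ^ 2) / 2 := by
        refine (abs_add_le _ _).trans (add_le_add ha ?_)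
        rw [abs_div, abs_of_pos (two_pos (α := ℝ))]
        gcongr
    _ ≤ |C| * rate n * R ^ 3 / 6 +
        ((∑ k, ∑ l, |(avgFisher F (V n) θ₀ - I₀) k l|) * R ^ 2) / 2 := by
        gcongr
        exact le_abs_self C
    _ ≤ ε := hn1.le

/-! ### Minimizers of convex, nearly quadratic functions with an `ℓ¹` penalty -/

section Deterministic

variable {κ : Type*} [Fintype κ]

lemma norm_le_sum_abs (u : EuclideanSpace ℝ κ) : ‖u‖ ≤ ∑ k, |u k| := by
  classical
  have h : u = ∑ k, u k • EuclideanSpace.single k (1 : ℝ) := by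
    ext i; simp [Pi.single_apply]
  conv_lhs => rw [h]
  refine (norm_sum_le _ _).trans_eq ?_
  simp [norm_smul]

/-- A positive definite quadratic form is bounded below by a multiple of the squared norm, its
minimum over the unit sphere. -/
lemma exists_pos_mul_norm_sq_le {S : Matrix κ κ ℝ} (hS : S.PosDef) :
    ∃ c > 0, ∀ u : EuclideanSpace ℝ κ, c * ‖u‖ ^ 2 ≤ u.ofLp ⬝ᵥ S *ᵥ u.ofLp := by
  classical
  have hpos : ∀ u : EuclideanSpace ℝ κ, u ≠ 0 → 0 < u.ofLp ⬝ᵥ S *ᵥ u.ofLp := fun u hu => by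
    have := hS.dotProduct_mulVec_pos (x := u.ofLp) (by simpa using hu)
    simpa using this
  rcases (Metric.sphere (0 : EuclideanSpace ℝ κ) 1).eq_empty_or_nonempty with he | hne
  · refine ⟨1, one_pos, fun u => ?_⟩
    by_cases hu : u = 0
    · simp [hu]
    · exfalso
      have : (‖u‖⁻¹ • u) ∈ Metric.sphere (0 : EuclideanSpace ℝ κ) 1 := by
        simp [norm_smul, norm_ne_zero_iff.2 hu]
      simp [he] at this
  · have hcont : Continuous fun u : EuclideanSpace ℝ κ => u.ofLp ⬝ᵥ S *ᵥ u.ofLp := by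
      simp only [dotProduct, Matrix.mulVec]; fun_prop
    obtain ⟨x, hx, hmin⟩ := (isCompact_sphere _ _).exists_isMinOn hne hcont.continuousOn
    have hx0 : x ≠ 0 := by rintro rfl; simp at hx
    refine ⟨_, hpos x hx0, fun u => ?_⟩
    by_cases hu : u = 0
    · simp [hu]
    have hn : ‖u‖ ≠ 0 := norm_ne_zero_iff.2 hu
    have hmem : (‖u‖⁻¹ • u) ∈ Metric.sphere (0 : EuclideanSpace ℝ κ) 1 := by
      simp [norm_smul, hn]
    have h := isMinOn_iff.1 hmin _ hmem
    simp only [WithLp.ofLp_smul, Matrix.mulVec_smul, dotProduct_smul, smul_dotProduct,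
      smul_eq_mul] at h
    calc _ ≤ ‖u‖⁻¹ * (‖u‖⁻¹ * (u.ofLp ⬝ᵥ S *ᵥ u.ofLp)) * ‖u‖ ^ 2 := by gcongr
      _ = _ := by field_simp

/-- The change of the weighted `ℓ¹` penalty between `θ₀` and `θ₀ + τ u`. -/
noncomputable def penaltyDiff (c : κ → ℝ) (θ₀ : EuclideanSpace ℝ κ) (τ : ℝ)
    (u : EuclideanSpace ℝ κ) : ℝ :=
  ∑ k, c k * (|θ₀ k + τ * u k| - |θ₀ k|)

/-- A penalized objective as a function of the scaled estimation error `u`: a linear term with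
slope `-Z`, a smooth part `f`, and the penalty. -/
noncomputable def localObjective (Z : EuclideanSpace ℝ κ) (f : EuclideanSpace ℝ κ → ℝ) (c : κ → ℝ)
    (θ₀ : EuclideanSpace ℝ κ) (τ : ℝ) (u : EuclideanSpace ℝ κ) : ℝ :=
  f u - inner ℝ u Z + penaltyDiff c θ₀ τ u

variable {Z : EuclideanSpace ℝ κ} {f : EuclideanSpace ℝ κ → ℝ} {c : κ → ℝ}
  {θ₀ : EuclideanSpace ℝ κ} {τ : ℝ}

lemma neg_le_penaltyDiff {α : ℝ} (hc : ∀ k, 0 ≤ c k) (hτ : 0 < τ) (hα : 0 ≤ α)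
    (hcα : ∀ k, θ₀ k ≠ 0 → c k * τ ≤ α) (u : EuclideanSpace ℝ κ) :
    -(α * Fintype.card κ * ‖u‖) ≤ penaltyDiff c θ₀ τ u := by
  have : ∀ k ∈ Finset.univ, -(α * ‖u‖) ≤ c k * (|θ₀ k + τ * u k| - |θ₀ k|) := fun k _ => by
    by_cases hk : θ₀ k = 0
    · have : 0 ≤ c k * (|θ₀ k + τ * u k| - |θ₀ k|) := by
        rw [hk, abs_zero, sub_zero]; exact mul_nonneg (hc k) (abs_nonneg _)
      have : 0 ≤ α * ‖u‖ := by positivity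
      linarith
    · have h1 : -(τ * |u k|) ≤ |θ₀ k + τ * u k| - |θ₀ k| := by
        have := abs_sub_abs_le_abs_sub (θ₀ k) (θ₀ k + τ * u k)
        rw [sub_add_cancel_left, abs_neg, abs_mul, abs_of_pos hτ] at this
        linarith
      have h2 : |u k| ≤ ‖u‖ := PiLp.norm_apply_le u k
      have h3 := mul_le_mul_of_nonneg_left h1 (hc k)
      have h4 : c k * τ * |u k| ≤ α * ‖u‖ :=
        mul_le_mul (hcα k hk) h2 (abs_nonneg _) hα
      linarith
  have h := Finset.sum_le_sum this
  simp only [Finset.sum_const, Finset.card_univ, nsmul_eq_mul] at h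
  rw [penaltyDiff]
  linarith

lemma penaltyDiff_smul_le (hc : ∀ k, 0 ≤ c k) (u : EuclideanSpace ℝ κ) {t : ℝ} (ht0 : 0 ≤ t)
    (ht1 : t ≤ 1) : penaltyDiff c θ₀ τ (t • u) ≤ t * penaltyDiff c θ₀ τ u := by
  simp only [penaltyDiff, Finset.mul_sum, PiLp.smul_apply, smul_eq_mul]
  refine Finset.sum_le_sum fun k _ => ?_
  have h : |θ₀ k + τ * (t * u k)| ≤ (1 - t) * |θ₀ k| + t * |θ₀ k + τ * u k| := by
    calc |θ₀ k + τ * (t * u k)| = |(1 - t) * θ₀ k + t * (θ₀ k + τ * u k)| := by congr 1; ring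
      _ ≤ _ := abs_add_le _ _
      _ = _ := by rw [abs_mul, abs_mul, abs_of_nonneg ht0, abs_of_nonneg (sub_nonneg.2 ht1)]
  calc c k * (|θ₀ k + τ * (t * u k)| - |θ₀ k|)
      ≤ c k * ((1 - t) * |θ₀ k| + t * |θ₀ k + τ * u k| - |θ₀ k|) := by
        gcongr; exact hc k
    _ = _ := by ring

/-- Localization: by convexity, a point where the objective does not exceed its value at `0` cannot
lie outside a ball on whose boundary the quadratic part dominates. -/
lemma norm_lt_of_localObjective_le {q : EuclideanSpace ℝ κ → ℝ} {c₀ α ε R R₁ : ℝ}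
    (hf : ConvexOn ℝ Set.univ f) (hf0 : f 0 = 0) (hc : ∀ k, 0 ≤ c k) (hτ : 0 < τ) (hα : 0 ≤ α)
    (hcα : ∀ k, θ₀ k ≠ 0 → c k * τ ≤ α) (hq : ∀ u, c₀ * ‖u‖ ^ 2 ≤ q u) (hR : 0 < R)
    (hfq : ∀ u, ‖u‖ ≤ R → |f u - q u / 2| ≤ ε) (hZ : ‖Z‖ ≤ R₁)
    (hdom : R₁ * R + ε + α * Fintype.card κ * R < c₀ * R ^ 2 / 2) {u : EuclideanSpace ℝ κ}
    (hu : localObjective Z f c θ₀ τ u ≤ 0) : ‖u‖ < R := by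
  by_contra! hcon
  have hn : 0 < ‖u‖ := hR.trans_le hcon
  -- Move `u` towards the origin, onto the sphere of radius `R`.
  set t := R / ‖u‖
  have ht0 : 0 ≤ t := by positivity
  have ht1 : t ≤ 1 := (div_le_one hn).2 hcon
  have hnorm : ‖t • u‖ = R := by
    rw [norm_smul, Real.norm_of_nonneg ht0, div_mul_cancel₀ _ hn.ne']
  have hft : f (t • u) ≤ t * f u := by
    have := hf.2 (Set.mem_univ u) (Set.mem_univ 0) ht0 (sub_nonneg.2 ht1) (by ring)
    simpa [hf0] using this
  have hpt := penaltyDiff_smul_le (τ := τ) (θ₀ := θ₀) hc u ht0 ht1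
  have hle : localObjective Z f c θ₀ τ (t • u) ≤ 0 := by
    have : localObjective Z f c θ₀ τ (t • u) ≤ t * localObjective Z f c θ₀ τ u := by
      rw [localObjective, localObjective, real_inner_smul_left]
      linarith
    exact this.trans (mul_nonpos_of_nonneg_of_nonpos ht0 hu)
  have h1 := (abs_le.1 (hfq (t • u) hnorm.le)).1
  have h2 := hq (t • u)
  have h3 := neg_le_penaltyDiff hc hτ hα hcα (t • u)
  have h4 : inner ℝ (t • u) Z ≤ R * R₁ :=
    (real_inner_le_norm _ _).trans (by rw [hnorm]; gcongr)
  rw [hnorm] at h2 h3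
  rw [localObjective] at hle
  linarith

/-- Selection: where the penalty on a zero coefficient exceeds the Lipschitz constant of the smooth
part, the minimizer keeps that coefficient at zero. -/
lemma apply_eq_zero_of_localObjective_le {L R : ℝ} (hτ : 0 < τ)
    (hLip : ∀ u v, ‖u‖ < R → ‖v‖ < R →
      (f u - inner ℝ u Z) - (f v - inner ℝ v Z) ≤ L * ‖u - v‖) (hL : 0 ≤ L)
    (hcL : ∀ k, θ₀ k = 0 → L < c k * τ) {u : EuclideanSpace ℝ κ} (huR : ‖u‖ < R)
    (hmin : ∀ v, ‖v‖ < R → localObjective Z f c θ₀ τ u ≤ localObjective Z f c θ₀ τ v)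
    (k : κ) (hk : θ₀ k = 0) : u k = 0 := by
  classical
  -- Compare `u` with the vector in which the coordinates off the support are set to zero.
  set v : EuclideanSpace ℝ κ := WithLp.toLp 2 fun k => if θ₀ k = 0 then 0 else u k with hv
  have hvR : ‖v‖ < R := by
    refine lt_of_le_of_lt ?_ huR
    rw [EuclideanSpace.norm_eq, EuclideanSpace.norm_eq]
    refine Real.sqrt_le_sqrt (Finset.sum_le_sum fun k _ => ?_)
    by_cases h : θ₀ k = 0 <;> simp [hv, h, sq_nonneg]
  have h1 := hmin v hvR
  have h2 := hLip v u hvR huR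
  have h3 : ‖v - u‖ ≤ ∑ k, if θ₀ k = 0 then |u k| else 0 := by
    refine (norm_le_sum_abs _).trans (Finset.sum_le_sum fun k _ => ?_)
    by_cases h : θ₀ k = 0 <;> simp [hv, h]
  have h4 : penaltyDiff c θ₀ τ u - penaltyDiff c θ₀ τ v =
      ∑ k, if θ₀ k = 0 then c k * τ * |u k| else 0 := by
    rw [penaltyDiff, penaltyDiff, ← Finset.sum_sub_distrib]
    refine Finset.sum_congr rfl fun k _ => ?_
    by_cases h : θ₀ k = 0
    · simp [hv, h, abs_mul, abs_of_pos hτ, mul_assoc]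
    · simp [hv, h]
  have h5 : ∑ k, (if θ₀ k = 0 then (c k * τ - L) * |u k| else 0) ≤ 0 := by
    have e : ∑ k, (if θ₀ k = 0 then (c k * τ - L) * |u k| else 0) =
        (∑ k, if θ₀ k = 0 then c k * τ * |u k| else 0) -
          L * ∑ k, if θ₀ k = 0 then |u k| else 0 := by
      rw [Finset.mul_sum, ← Finset.sum_sub_distrib]
      refine Finset.sum_congr rfl fun k _ => ?_
      split_ifs <;> ring
    rw [e, ← h4]
    have := mul_le_mul_of_nonneg_left h3 hL
    rw [localObjective, localObjective] at h1
    linarith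
  have hnn : ∀ k ∈ Finset.univ, 0 ≤ if θ₀ k = 0 then (c k * τ - L) * |u k| else 0 := fun k _ => by
    split_ifs with h
    · exact mul_nonneg (sub_nonneg.2 (hcL k h).le) (abs_nonneg _)
    · exact le_rfl
  have h6 := (Finset.sum_eq_zero_iff_of_nonneg hnn).1
    (le_antisymm h5 (Finset.sum_nonneg hnn)) k (Finset.mem_univ k)
  rw [if_pos hk, mul_eq_zero] at h6
  rcases h6 with h6 | h6
  · exact absurd h6 (sub_pos.2 (hcL k hk)).ne'
  · exact abs_eq_zero.1 h6

/-- Expansion: among vectors supported where `θ₀` is nonzero, a point that does not do worse than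
the minimizer `v` of the quadratic approximation is close to `v`. -/
lemma mul_norm_sub_sq_le_of_localObjective_le {S : Matrix κ κ ℝ} (hS : S.IsHermitian)
    {c₀ α ε R : ℝ}
    (hq : ∀ u : EuclideanSpace ℝ κ, c₀ * ‖u‖ ^ 2 ≤ u.ofLp ⬝ᵥ S *ᵥ u.ofLp)
    (hc : ∀ k, 0 ≤ c k) (hτ : 0 < τ) (hα : 0 ≤ α)
    (hcα : ∀ k, θ₀ k ≠ 0 → c k * τ ≤ α)
    (hfq : ∀ u, ‖u‖ ≤ R → |f u - u.ofLp ⬝ᵥ S *ᵥ u.ofLp / 2| ≤ ε) {u v : EuclideanSpace ℝ κ}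
    (huR : ‖u‖ ≤ R) (hvR : ‖v‖ ≤ R) (hu0 : ∀ k, θ₀ k = 0 → u k = 0)
    (hv0 : ∀ k, θ₀ k = 0 → v k = 0)
    (hv : inner ℝ (u - v) Z = (u - v).ofLp ⬝ᵥ S *ᵥ v.ofLp)
    (huv : localObjective Z f c θ₀ τ u ≤ localObjective Z f c θ₀ τ v) :
    c₀ * ‖u - v‖ ^ 2 ≤ 4 * ε + 4 * α * Fintype.card κ * R := by
  have hsym : u.ofLp ⬝ᵥ S *ᵥ v.ofLp = v.ofLp ⬝ᵥ S *ᵥ u.ofLp := by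
    rw [Matrix.dotProduct_mulVec, ← Matrix.mulVec_transpose, dotProduct_comm]
    have : Sᵀ = S := by simpa using hS.eq
    rw [this]
  have hquad : (u - v).ofLp ⬝ᵥ S *ᵥ (u - v).ofLp = u.ofLp ⬝ᵥ S *ᵥ u.ofLp -
      v.ofLp ⬝ᵥ S *ᵥ v.ofLp - 2 * ((u - v).ofLp ⬝ᵥ S *ᵥ v.ofLp) := by
    simp only [WithLp.ofLp_sub, Matrix.mulVec_sub, dotProduct_sub, sub_dotProduct, hsym]
    ring
  have hpen : penaltyDiff c θ₀ τ v - penaltyDiff c θ₀ τ u ≤ 2 * α * Fintype.card κ * R := by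
    have hk : ∀ k ∈ Finset.univ, c k * (|θ₀ k + τ * v k| - |θ₀ k|) -
        c k * (|θ₀ k + τ * u k| - |θ₀ k|) ≤ α * (2 * R) := fun k _ => by
      have hR : 0 ≤ R := (norm_nonneg u).trans huR
      by_cases h : θ₀ k = 0
      · rw [hu0 k h, hv0 k h, sub_self]; positivity
      have h1 : |θ₀ k + τ * v k| - |θ₀ k + τ * u k| ≤ τ * |v k - u k| := by
        refine (abs_sub_abs_le_abs_sub _ _).trans_eq ?_
        rw [← abs_of_pos hτ, ← abs_mul, abs_of_pos hτ]; congr 1; ring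
      have h2 : |v k - u k| ≤ 2 * R := by
        have hv' : |v k| ≤ ‖v‖ := PiLp.norm_apply_le v k
        have hu' : |u k| ≤ ‖u‖ := PiLp.norm_apply_le u k
        have := abs_sub (v k) (u k)
        linarith
      calc _ = c k * (|θ₀ k + τ * v k| - |θ₀ k + τ * u k|) := by ring
        _ ≤ c k * (τ * |v k - u k|) := mul_le_mul_of_nonneg_left h1 (hc k)
        _ = c k * τ * |v k - u k| := by ring
        _ ≤ α * (2 * R) := mul_le_mul (hcα k h) h2 (abs_nonneg _) hα
    have := Finset.sum_le_sum hk
    rw [Finset.sum_sub_distrib] at this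
    simp only [Finset.sum_const, Finset.card_univ, nsmul_eq_mul] at this
    rw [penaltyDiff, penaltyDiff]
    linarith
  have h1 := abs_le.1 (hfq u huR)
  have h2 := abs_le.1 (hfq v hvR)
  have h3 := hq (u - v)
  rw [inner_sub_left] at hv
  rw [localObjective, localObjective] at huv
  linarith [h1.1, h2.2]

/-! ### Submatrices and coordinate projections -/

variable [DecidableEq κ]

open scoped Classical in
/-- Extension by zero of a vector of coordinates indexed by `A`. -/
noncomputable def extendZero (A : Set κ) (x : A → ℝ) : EuclideanSpace ℝ κ :=
  WithLp.toLp 2 fun k => if h : k ∈ A then x ⟨k, h⟩ else 0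

omit [DecidableEq κ] in
open scoped Classical in
lemma sum_extendZero_mul (A : Set κ) (x : A → ℝ) (y : κ → ℝ) :
    ∑ k, extendZero A x k * y k = ∑ a : A, x a * y a := by
  have h : ∀ k, extendZero A x k * y k =
      if h : k ∈ A then x ⟨k, h⟩ * y k else 0 := fun k => by
    simp only [extendZero]; split_ifs <;> simp
  simp only [h]
  rw [Finset.sum_dite, Finset.sum_const_zero, add_zero]
  refine Finset.sum_bij' (fun k _ => ⟨k.1, (Finset.mem_filter.1 k.2).2⟩)
    (fun a _ => ⟨a.1, by simp⟩) ?_ ?_ ?_ ?_ ?_ <;> simp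

open scoped Classical in
/-- The minimizer of `u ↦ uᵀ S u / 2 - uᵀ Z` among the vectors supported in `A`. -/
noncomputable def supportedMin (S : Matrix κ κ ℝ) (A : Set κ) (Z : EuclideanSpace ℝ κ) :
    EuclideanSpace ℝ κ :=
  extendZero A ((S.submatrix (fun k : A => (k : κ)) (fun k : A => (k : κ)))⁻¹ *ᵥ fun a => Z a)

/-- The normal equations of `supportedMin`: on `A`, the vector `S u` agrees with `Z`. -/
lemma dotProduct_mulVec_supportedMin {S : Matrix κ κ ℝ} (hS : S.PosDef) (A : Set κ)
    (Z w : EuclideanSpace ℝ κ) (hw : ∀ k, k ∉ A → w k = 0) :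
    inner ℝ w Z = w.ofLp ⬝ᵥ S *ᵥ (supportedMin S A Z).ofLp := by
  classical
  have hdet : IsUnit (S.submatrix (fun k : A => (k : κ)) (fun k : A => (k : κ))).det :=
    ((hS.submatrix Subtype.val_injective).isUnit.map Matrix.detMonoidHom)
  have hk : ∀ k ∈ A, (S *ᵥ (supportedMin S A Z).ofLp) k = Z k := fun k hk => by
    have h1 : (S *ᵥ (supportedMin S A Z).ofLp) k = ∑ l, (supportedMin S A Z) l * S k l := by
      simp only [Matrix.mulVec, dotProduct]
      exact Finset.sum_congr rfl fun _ _ => mul_comm _ _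
    have h2 := congrFun (Matrix.mulVec_mulVec (fun a : A => Z a)
      (S.submatrix (fun k : A => (k : κ)) (fun k : A => (k : κ)))
      (S.submatrix (fun k : A => (k : κ)) (fun k : A => (k : κ)))⁻¹) ⟨k, hk⟩
    rw [Matrix.mul_nonsing_inv _ hdet, Matrix.one_mulVec] at h2
    rw [h1, supportedMin, sum_extendZero_mul, ← h2]
    simp only [Matrix.mulVec, dotProduct, Matrix.submatrix_apply]
    exact Finset.sum_congr rfl fun _ _ => mul_comm _ _
  rw [PiLp.inner_apply, dotProduct]
  refine Finset.sum_congr rfl fun k _ => ?_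
  by_cases h : k ∈ A
  · rw [hk k h]; simp [mul_comm]
  · simp [hw k h]

lemma supportedMin_apply_eq_zero (S : Matrix κ κ ℝ) (A : Set κ) (Z : EuclideanSpace ℝ κ) {k : κ}
    (hk : k ∉ A) : supportedMin S A Z k = 0 := by
  simp [supportedMin, extendZero, hk]

/-- Sparsity and asymptotic linearity of the minimizer: for a score `Z` in a fixed ball, a small
penalty on the nonzero coefficients and a large one on the zero coefficients, a minimizer of a
convex, nearly quadratic objective vanishes off the support of `θ₀` and is close to the minimizer of
the quadratic approximation on the support. -/
theorem exists_minimizer_bounds {S : Matrix κ κ ℝ} (hS : S.PosDef) {R₁ η : ℝ} (hR₁ : 0 ≤ R₁)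
    (hη : 0 < η) :
    ∃ α > 0, ∃ L ≥ 0, ∃ R > 0, ∃ ε > 0, ∀ (Z : EuclideanSpace ℝ κ) (f : EuclideanSpace ℝ κ → ℝ)
      (c : κ → ℝ) (θ₀ : EuclideanSpace ℝ κ) (τ : ℝ) (u : EuclideanSpace ℝ κ),
      ConvexOn ℝ Set.univ f → f 0 = 0 →
      (∀ v : EuclideanSpace ℝ κ, ‖v‖ ≤ 2 * R → |f v - v.ofLp ⬝ᵥ S *ᵥ v.ofLp / 2| ≤ ε) →
      ‖Z‖ ≤ R₁ → (∀ k, 0 ≤ c k) → 0 < τ → (∀ k, θ₀ k ≠ 0 → c k * τ ≤ α) →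
      (∀ k, θ₀ k = 0 → L < c k * τ) →
      (∀ v, ‖v‖ ≤ R → localObjective Z f c θ₀ τ u ≤ localObjective Z f c θ₀ τ v) →
      (∀ k, θ₀ k = 0 → u k = 0) ∧ ‖u - supportedMin S {k | θ₀ k ≠ 0} Z‖ ≤ η := by
  obtain ⟨c₀, hc₀, hq⟩ := exists_pos_mul_norm_sq_le hS
  set p : ℝ := (Fintype.card κ : ℝ) with hp
  have hp0 : 0 ≤ p := Nat.cast_nonneg _
  set B : ℝ := ∑ k, ∑ l, |S k l| with hB
  -- The radius makes the quadratic part win on the boundary of the ball.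
  set R : ℝ := 1 + 2 * (R₁ + p + 1) / c₀ with hR
  have hR1 : 1 ≤ R := by rw [hR]; linarith [show 0 ≤ 2 * (R₁ + p + 1) / c₀ by positivity]
  have hR0 : 0 < R := by linarith
  have hRc : c₀ * R = c₀ + 2 * (R₁ + p + 1) := by rw [hR]; field_simp
  set ε : ℝ := min 1 (c₀ * η ^ 2 / 8) with hε
  set α : ℝ := min 1 (c₀ * η ^ 2 / (8 * (p * R + 1))) with hα
  have hε0 : 0 < ε := lt_min one_pos (by positivity)
  have hα0 : 0 < α := lt_min one_pos (by positivity)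
  have hε1 : ε ≤ 1 := min_le_left _ _
  have hα1 : α ≤ 1 := min_le_left _ _
  have hB0 : 0 ≤ B := Finset.sum_nonneg fun _ _ => Finset.sum_nonneg fun _ _ => abs_nonneg _
  set M : ℝ := B * (2 * R) ^ 2 / 2 + ε + 2 * R * R₁ with hM
  have hM0 : 0 ≤ M := by positivity
  refine ⟨α, hα0, 2 * M / R, by positivity, R, hR0, ε, hε0, ?_⟩
  intro Z f c θ₀ τ u hf hf0 hfq hZ hc hτ hcα hcL hmin
  have hfqR : ∀ v : EuclideanSpace ℝ κ, ‖v‖ ≤ R → |f v - v.ofLp ⬝ᵥ S *ᵥ v.ofLp / 2| ≤ ε :=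
    fun v hv => hfq v (by linarith)
  have hu0 : localObjective Z f c θ₀ τ u ≤ 0 := by
    have := hmin 0 (by simpa using hR0.le)
    simpa [localObjective, penaltyDiff, hf0] using this
  have huR : ‖u‖ < R := by
    refine norm_lt_of_localObjective_le (q := fun u => u.ofLp ⬝ᵥ S *ᵥ u.ofLp) hf hf0 hc hτ hα0.le
      hcα hq hR0 hfqR hZ ?_ hu0
    have h1 : α * p * R ≤ p * R := by
      calc α * p * R ≤ 1 * p * R := by gcongr
        _ = p * R := by ring
    have h2 : c₀ * R ^ 2 / 2 = c₀ * R / 2 + c₀ * R / 2 * (R - 1) := by ring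
    nlinarith
  -- A convex function bounded on a ball is Lipschitz on a smaller one.
  have hLip : ∀ u v, ‖u‖ < R → ‖v‖ < R →
      (f u - inner ℝ u Z) - (f v - inner ℝ v Z) ≤ 2 * M / R * ‖u - v‖ := by
    have hconv : ConvexOn ℝ Set.univ fun u : EuclideanSpace ℝ κ => f u - inner ℝ u Z := by
      refine hf.sub ⟨convex_univ, fun x _ y _ a b _ _ _ => ?_⟩
      simp [inner_add_left, real_inner_smul_left]
    have hb : ∀ a : EuclideanSpace ℝ κ, dist a 0 < 2 * R → |f a - inner ℝ a Z| ≤ M := by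
      intro a ha
      rw [dist_zero_right] at ha
      have h1 := hfq a ha.le
      have h2 := abs_dotProduct_mulVec_le S a
      have h3 : |inner ℝ a Z| ≤ 2 * R * R₁ :=
        (abs_real_inner_le_norm a Z).trans (mul_le_mul ha.le hZ (norm_nonneg _) (by positivity))
      have h4 : B * ‖a‖ ^ 2 ≤ B * (2 * R) ^ 2 := by gcongr
      rw [← hB] at h2
      rw [abs_le] at *
      constructor <;> linarith [h1.1, h1.2, h2.1, h2.2, h3.1, h3.2]
    have hl := (hconv.subset (Set.subset_univ _) (convex_ball 0 (2 * R))).lipschitzOnWith_of_abs_le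
      hR0 hb
    intro u v hu hv
    have hmem : ∀ w : EuclideanSpace ℝ κ, ‖w‖ < R → w ∈ Metric.ball 0 (2 * R - R) := fun w hw => by
      rw [mem_ball_zero_iff]; linarith
    have := hl.dist_le_mul u (hmem u hu) v (hmem v hv)
    rw [Real.coe_toNNReal _ (by positivity), dist_eq_norm, dist_eq_norm] at this
    exact (le_abs_self _).trans this
  have hzero := apply_eq_zero_of_localObjective_le hτ hLip (by positivity) hcL huR
    fun v hv => hmin v hv.le
  refine ⟨hzero, ?_⟩
  set v := supportedMin S {k | θ₀ k ≠ 0} Z with hv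
  have hv0 : ∀ k, θ₀ k = 0 → v k = 0 := fun k hk =>
    supportedMin_apply_eq_zero S _ Z (by simpa using hk)
  have hvR : ‖v‖ ≤ R := by
    have h1 := dotProduct_mulVec_supportedMin hS {k | θ₀ k ≠ 0} Z v
      fun k hk => hv0 k (by simpa using hk)
    have h2 := hq v
    have h3 : inner ℝ v Z ≤ ‖v‖ * R₁ := (real_inner_le_norm _ _).trans (by gcongr)
    by_contra! hcon
    have h4 : c₀ * ‖v‖ ≤ R₁ := by
      have : 0 < ‖v‖ := hR0.trans hcon
      rw [← hv] at h1
      nlinarith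
    have h5 : c₀ * R < c₀ * ‖v‖ := by gcongr
    linarith
  have hcomp := mul_norm_sub_sq_le_of_localObjective_le hS.isHermitian hq hc hτ hα0.le hcα hfqR
    huR.le hvR hzero hv0
    (dotProduct_mulVec_supportedMin hS {k | θ₀ k ≠ 0} Z (u - v) fun k hk => by
      have hk' : θ₀ k = 0 := by simpa using hk
      simp [hzero k hk', hv0 k hk']) (hmin v hvR)
  have h1 : 4 * ε ≤ c₀ * η ^ 2 / 2 := by linarith [min_le_right 1 (c₀ * η ^ 2 / 8)]
  have h2 : 4 * α * p * R ≤ c₀ * η ^ 2 / 2 := by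
    have h3 : α * (8 * (p * R + 1)) ≤ c₀ * η ^ 2 :=
      (le_div_iff₀ (by positivity)).1 (min_le_right _ _)
    linarith
  have h3 : c₀ * ‖u - v‖ ^ 2 ≤ c₀ * η ^ 2 := by linarith
  exact (sq_le_sq₀ (norm_nonneg _) hη.le).1 (le_of_mul_le_mul_left h3 hc₀)

end Deterministic

end DirectedNetwork

/-! ### Characteristic functions in the limit -/

lemma norm_exp_mul_I_sub_le (a b : ℝ) :
    ‖Complex.exp (a * Complex.I) - Complex.exp (b * Complex.I)‖ ≤ |a - b| := by
  have h : Complex.exp (a * Complex.I) - Complex.exp (b * Complex.I) =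
      Complex.exp (b * Complex.I) * (Complex.exp (Complex.I * (a - b : ℝ)) - 1) := by
    rw [mul_sub, ← Complex.exp_add, mul_one]
    congr 2
    push_cast; ring
  rw [h, norm_mul, Complex.norm_exp_ofReal_mul_I, one_mul]
  exact Real.norm_exp_I_mul_ofReal_sub_one_le

lemma integrable_exp_mul_I {Ω : Type*} [MeasurableSpace Ω] {P : Measure Ω} [IsFiniteMeasure P]
    {Y : Ω → ℝ} (hY : AEMeasurable Y P) :
    Integrable (fun ω => Complex.exp (Y ω * Complex.I)) P := by
  refine Integrable.of_bound (C := 1) ?_ (Eventually.of_forall fun ω => ?_)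
  · exact AEMeasurable.aestronglyMeasurable (by fun_prop)
  · rw [Complex.norm_exp_ofReal_mul_I]

/-- Random variables on varying probability spaces that differ by a null sequence in probability
have the same limit of `E exp (i Y)`. -/
lemma tendsto_integral_exp_of_sub_tendsto {Ω : ℕ → Type*} [∀ n, MeasurableSpace (Ω n)]
    {P : (n : ℕ) → Measure (Ω n)} [∀ n, IsProbabilityMeasure (P n)] {Y W : (n : ℕ) → Ω n → ℝ}
    (hY : ∀ n, AEMeasurable (Y n) (P n)) (hW : ∀ n, AEMeasurable (W n) (P n))
    (h : ∀ ε > 0, Tendsto (fun n => P n {ω | ε < |Y n ω - W n ω|}) atTop (𝓝 0)) {z : ℂ}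
    (hz : Tendsto (fun n => ∫ ω, Complex.exp (W n ω * Complex.I) ∂(P n)) atTop (𝓝 z)) :
    Tendsto (fun n => ∫ ω, Complex.exp (Y n ω * Complex.I) ∂(P n)) atTop (𝓝 z) := by
  have key : ∀ n, ∀ ε > 0, ‖∫ ω, Complex.exp (Y n ω * Complex.I) ∂(P n) -
      ∫ ω, Complex.exp (W n ω * Complex.I) ∂(P n)‖ ≤
        ε + 2 * (P n).real {ω | ε < |Y n ω - W n ω|} := by
    intro n ε hε
    have hs : NullMeasurableSet {ω | ε < |Y n ω - W n ω|} (P n) :=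
      nullMeasurableSet_lt (by fun_prop) ((hY n).sub (hW n)).abs
    rw [← integral_sub (integrable_exp_mul_I (hY n)) (integrable_exp_mul_I (hW n))]
    refine (norm_integral_le_integral_norm _).trans ?_
    have hi : Integrable ({ω | ε < |Y n ω - W n ω|}.indicator fun _ => (2 : ℝ)) (P n) :=
      (integrable_const _).indicator₀ hs
    calc _ ≤ ∫ ω, (ε + {ω | ε < |Y n ω - W n ω|}.indicator (fun _ => (2 : ℝ)) ω) ∂(P n) := by
          refine integral_mono ((integrable_exp_mul_I (hY n)).sub
            (integrable_exp_mul_I (hW n))).norm ((integrable_const _).add hi) fun ω => ?_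
          by_cases hω : ε < |Y n ω - W n ω|
          · rw [Set.indicator_of_mem (show ω ∈ {ω | ε < |Y n ω - W n ω|} from hω)]
            refine (norm_sub_le _ _).trans ?_
            rw [Complex.norm_exp_ofReal_mul_I, Complex.norm_exp_ofReal_mul_I]
            linarith
          · rw [Set.indicator_of_notMem (show ω ∉ {ω | ε < |Y n ω - W n ω|} from hω), add_zero]
            exact (norm_exp_mul_I_sub_le _ _).trans (not_lt.1 hω)
      _ = _ := by
          rw [integral_add (integrable_const _) hi, integral_indicator₀ hs]
          simp [mul_comm]
  have hdiff : Tendsto (fun n => ∫ ω, Complex.exp (Y n ω * Complex.I) ∂(P n) -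
      ∫ ω, Complex.exp (W n ω * Complex.I) ∂(P n)) atTop (𝓝 0) := by
    rw [Metric.tendsto_nhds]
    intro ε hε
    have h1 : Tendsto (fun n => 2 * (P n).real {ω | ε / 2 < |Y n ω - W n ω|}) atTop
        (𝓝 (2 * 0)) :=
      ((ENNReal.tendsto_toReal ENNReal.zero_ne_top).comp (h (ε / 2) (by positivity))).const_mul 2
    rw [mul_zero] at h1
    filter_upwards [h1.eventually_lt_const (half_pos hε)] with n hn
    rw [dist_zero_right]
    linarith [key n (ε / 2) (by positivity)]
  simpa using hdiff.add hz

namespace DirectedNetwork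

open scoped Matrix

/-! ### Asymptotic normality of the score -/

section Score

variable {m : ℕ} {r : Fin m → ℕ} (F : FeatureMaps r)

lemma integral_comp_network {n : ℕ} (V : Fin n → NodeFeatures r) (θ₀ : Param m) {Ω : Type*}
    [MeasurableSpace Ω] {P : Measure Ω} [IsProbabilityMeasure P] {X : Ω → Network n}
    (hX : Measurable X)
    (hlaw : ∀ x : Network n, P.real (X ⁻¹' {x}) = networkProb F V θ₀ x) (g : Network n → ℝ) :
    ∫ ω, g (X ω) ∂P = ∑ x, networkProb F V θ₀ x * g x := by
  have : IsProbabilityMeasure (P.map X) := Measure.isProbabilityMeasure_map hX.aemeasurable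
  rw [← integral_map (f := g) hX.aemeasurable (measurable_of_finite g).aestronglyMeasurable,
    integral_fintype .of_finite]
  refine Finset.sum_congr rfl fun x _ => ?_
  rw [map_measureReal_apply hX (measurableSet_singleton x), hlaw, smul_eq_mul]

variable {V : (n : ℕ) → Fin n → NodeFeatures r} {θ₀ : Param m}
  {I₀ : Matrix (ParamIdx m) (ParamIdx m) ℝ} {Ω : ℕ → Type*} [∀ n, MeasurableSpace (Ω n)]
  {P : (n : ℕ) → Measure (Ω n)} [∀ n, IsProbabilityMeasure (P n)]
  {X : (n : ℕ) → Ω n → Network n}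

/-- The score of the observed network at `θ₀`, divided by `√N`. -/
noncomputable def observedScore (V : (n : ℕ) → Fin n → NodeFeatures r) (θ₀ : Param m)
    (X : (n : ℕ) → Ω n → Network n) (n : ℕ) (ω : Ω n) : Param m :=
  scaledScore F (V n) θ₀ (rate n) (X n ω)

lemma measurable_observedScore (hX : ∀ n, Measurable (X n)) (n : ℕ) :
    Measurable (observedScore F V θ₀ X n) :=
  (measurable_of_finite (scaledScore F (V n) θ₀ (rate n))).comp (hX n)

/-- The scaled score is asymptotically normal, because its moment generating functions converge. -/
lemma tendsto_integral_exp_inner_observedScore (hI : InformationCondition F V θ₀ I₀)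
    (hT : ThirdDerivativeCondition F V θ₀) (hX : ∀ n, Measurable (X n))
    (hlaw : ∀ n, ∀ x : Network n, (P n).real (X n ⁻¹' {x}) = networkProb F (V n) θ₀ x)
    (v : Param m) :
    Tendsto (fun n => ∫ ω, Complex.exp ((inner ℝ v (observedScore F V θ₀ X n ω) : ℝ) * Complex.I)
      ∂(P n)) atTop (𝓝 (Complex.exp (-((v.ofLp ⬝ᵥ I₀ *ᵥ v.ofLp : ℝ) : ℂ) / 2))) := by
  have hYm : ∀ n, Measurable fun ω => inner ℝ v (observedScore F V θ₀ X n ω) := fun n =>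
    (measurable_observedScore F hX n).const_inner
  have hprob : ∀ n, IsProbabilityMeasure
      ((P n).map fun ω => inner ℝ v (observedScore F V θ₀ X n ω)) := fun n =>
    Measure.isProbabilityMeasure_map (hYm n).aemeasurable
  set μ : ℕ → ProbabilityMeasure ℝ := fun n =>
    ⟨(P n).map fun ω => inner ℝ v (observedScore F V θ₀ X n ω), hprob n⟩ with hμ
  have hnn : 0 ≤ v.ofLp ⬝ᵥ I₀ *ᵥ v.ofLp := by
    simpa using hI.2.posSemidef.dotProduct_mulVec_nonneg v.ofLp
  have hint : ∀ n, ∀ t : ℝ, Integrable (fun x => Real.exp (t * x)) (μ n : Measure ℝ) :=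
    fun n t => by
    refine (integrable_map_measure (by fun_prop) (hYm n).aemeasurable).2 ?_
    have := (integrable_map_measure (f := X n) (μ := P n) (g := fun x =>
      Real.exp (t * inner ℝ v (scaledScore F (V n) θ₀ (rate n) x)))
      (measurable_of_finite _).aestronglyMeasurable (hX n).aemeasurable).1
    have hp : IsProbabilityMeasure ((P n).map (X n)) :=
      Measure.isProbabilityMeasure_map (hX n).aemeasurable
    exact this .of_finite
  have hmgf : ∀ n, ∀ t : ℝ, mgf id (μ n : Measure ℝ) t =
      Real.exp (centredPot F (V n) θ₀ (rate n) (t • v)) := fun n t => by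
    rw [← sum_networkProb_mul_exp, ← integral_comp_network F (V n) θ₀ (hX n) (hlaw n)]
    simp only [hμ, ProbabilityMeasure.coe_mk]
    rw [mgf_id_map (hYm n).aemeasurable, mgf]
    simp only [real_inner_smul_left]
    rfl
  have hconv : ∀ t : ℝ, Tendsto (fun n => mgf id (μ n : Measure ℝ) t) atTop
      (𝓝 (Real.exp ((v.ofLp ⬝ᵥ I₀ *ᵥ v.ofLp).toNNReal * t ^ 2 / 2))) := fun t => by
    simp only [hmgf]
    refine (Real.continuous_exp.tendsto _).comp ?_
    have e : (v.ofLp ⬝ᵥ I₀ *ᵥ v.ofLp).toNNReal * t ^ 2 / 2 =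
        (t • v).ofLp ⬝ᵥ I₀ *ᵥ (t • v).ofLp / 2 := by
      rw [Real.coe_toNNReal _ hnn]
      simp only [WithLp.ofLp_smul, Matrix.mulVec_smul, dotProduct_smul, smul_dotProduct,
        smul_eq_mul]
      ring
    rw [e, Metric.tendsto_nhds]
    intro ε hε
    filter_upwards [eventually_abs_centredPot_sub_le F V θ₀ I₀ hI.1 hT ‖t • v‖ (half_pos hε)]
      with n hn
    rw [Real.dist_eq]
    linarith [hn (t • v) le_rfl]
  have hlim := ProbabilityMeasure.tendsto_iff_tendsto_charFun.1
    (tendsto_gaussianReal_of_tendsto_mgf hint hconv) 1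
  have hl : charFun (gaussianReal 0 (v.ofLp ⬝ᵥ I₀ *ᵥ v.ofLp).toNNReal) 1 =
      Complex.exp (-((v.ofLp ⬝ᵥ I₀ *ᵥ v.ofLp : ℝ) : ℂ) / 2) := by
    rw [charFun_gaussianReal]
    have : (((v.ofLp ⬝ᵥ I₀ *ᵥ v.ofLp).toNNReal : ℝ) : ℂ) = ((v.ofLp ⬝ᵥ I₀ *ᵥ v.ofLp : ℝ) : ℂ) := by
      rw [Real.coe_toNNReal _ hnn]
    rw [this]
    congr 1
    simp; ring
  simp only [ProbabilityMeasure.coe_mk] at hlim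
  rw [hl] at hlim
  refine hlim.congr fun n => ?_
  simp only [hμ, ProbabilityMeasure.coe_mk]
  rw [charFun_apply_real, integral_map (hYm n).aemeasurable (by fun_prop)]
  simp

/-- The scaled score is bounded in probability. -/
lemma exists_measure_norm_observedScore_gt_le (hI : InformationCondition F V θ₀ I₀)
    (hT : ThirdDerivativeCondition F V θ₀) (hX : ∀ n, Measurable (X n))
    (hlaw : ∀ n, ∀ x : Network n, (P n).real (X n ⁻¹' {x}) = networkProb F (V n) θ₀ x)
    {δ : ℝ≥0∞} (hδ : 0 < δ) :
    ∃ R ≥ 0, ∀ n, P n {ω | R < ‖observedScore F V θ₀ X n ω‖} ≤ δ := by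
  have hm := fun n => measurable_observedScore (V := V) (θ₀ := θ₀) F hX n
  have hprob : ∀ n, IsProbabilityMeasure ((P n).map (observedScore F V θ₀ X n)) := fun n =>
    Measure.isProbabilityMeasure_map (hm n).aemeasurable
  have htight : IsTightMeasureSet
      (Set.range fun n => (P n).map (observedScore F V θ₀ X n)) := by
    refine isTightMeasureSet_of_tendsto_charFun
      (f := fun v : Param m => Complex.exp (-((v.ofLp ⬝ᵥ I₀ *ᵥ v.ofLp : ℝ) : ℂ) / 2)) ?_
      fun v => ?_
    · refine Continuous.continuousAt ?_
      simp only [dotProduct, Matrix.mulVec]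
      fun_prop
    · refine (tendsto_integral_exp_inner_observedScore F hI hT hX hlaw v).congr fun n => ?_
      rw [charFun_apply, integral_map (hm n).aemeasurable
        (Continuous.aestronglyMeasurable (by fun_prop))]
      simp only [real_inner_comm]
  have h0 := (ENNReal.tendsto_nhds_zero.1
    (tendsto_measure_norm_gt_of_isTightMeasureSet htight)) δ hδ
  obtain ⟨R, hR, hR0⟩ := (h0.and (eventually_ge_atTop (0 : ℝ))).exists
  refine ⟨R, hR0, fun n => ?_⟩
  have h1 : (P n).map (observedScore F V θ₀ X n) {x | R < ‖x‖} ≤ δ :=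
    (le_iSup₂_of_le (f := fun (μ : Measure (Param m)) _ => μ {x | R < ‖x‖}) _ ⟨n, rfl⟩
      le_rfl).trans hR
  rwa [Measure.map_apply (hm n) (measurableSet_lt measurable_const measurable_norm)] at h1

end Score

/-! ### The penalized estimator -/

section Estimator

variable {m : ℕ} {r : Fin m → ℕ} (F : FeatureMaps r)

lemma objective_sub {n : ℕ} (V : Fin n → NodeFeatures r) (lam : ℝ≥0) (w : ParamIdx m → ℝ≥0)
    (x : Network n) (θ₀ : Param m) (τ : ℝ) (u : Param m) :
    objective F V lam w x (θ₀ + τ • u) - objective F V lam w x θ₀ =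
      localObjective (scaledScore F V θ₀ τ x) (centredPot F V θ₀ τ)
        (fun k => (lam : ℝ) * w k) θ₀ τ u := by
  have h := logLik_sub F V θ₀ τ u x
  have hp : penaltyDiff (fun k => (lam : ℝ) * w k) θ₀ τ u =
      lam * ∑ k, w k * |(θ₀ + τ • u) k| - lam * ∑ k, w k * |θ₀ k| := by
    rw [← mul_sub, ← Finset.sum_sub_distrib, penaltyDiff, Finset.mul_sum]
    exact Finset.sum_congr rfl fun k _ => by simp; ring
  rw [localObjective, hp, objective, objective]
  linarith

lemma penalty_mul_inv_le_of_maxPenalty {θ₀ : Param m} {lam : ℝ≥0} {w : ParamIdx m → ℝ≥0} {s : ℝ}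
    (hs : 0 < s) {α : ℝ≥0} (h : ¬ (α : ℝ≥0∞) ≤ maxPenalty θ₀ lam w / ENNReal.ofReal s)
    (k : ParamIdx m) (hk : θ₀ k ≠ 0) : (lam : ℝ) * w k * s⁻¹ ≤ α := by
  have h1 : ((lam * w k : ℝ≥0) : ℝ≥0∞) ≤ maxPenalty θ₀ lam w :=
    le_iSup₂_of_le (f := fun k (_ : k ∈ support θ₀) => ((lam * w k : ℝ≥0) : ℝ≥0∞)) k hk le_rfl
  have hs0 : ENNReal.ofReal s ≠ 0 := by simpa using hs
  rw [not_le, ENNReal.div_lt_iff (Or.inl hs0) (Or.inl ENNReal.ofReal_ne_top)] at h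
  have h2 := h1.trans_lt h
  rw [ENNReal.ofReal, ← ENNReal.coe_mul, ENNReal.coe_lt_coe, ← NNReal.coe_lt_coe] at h2
  push_cast at h2
  rw [Real.coe_toNNReal _ hs.le] at h2
  rw [← div_eq_mul_inv, div_le_iff₀ hs]
  exact h2.le

lemma lt_penalty_mul_inv_of_minPenalty {θ₀ : Param m} {lam : ℝ≥0} {w : ParamIdx m → ℝ≥0} {s : ℝ}
    (hs : 0 < s) {L : ℝ≥0} (h : ¬ minPenalty θ₀ lam w / ENNReal.ofReal s ≤ (L : ℝ≥0∞))
    (k : ParamIdx m) (hk : θ₀ k = 0) : L < (lam : ℝ) * w k * s⁻¹ := by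
  have h1 : minPenalty θ₀ lam w ≤ ((lam * w k : ℝ≥0) : ℝ≥0∞) :=
    iInf₂_le_of_le (f := fun k (_ : k ∈ (support θ₀)ᶜ) => ((lam * w k : ℝ≥0) : ℝ≥0∞)) k
      (by simpa [support] using hk) le_rfl
  have hs0 : ENNReal.ofReal s ≠ 0 := by simpa using hs
  rw [not_le, ENNReal.lt_div_iff_mul_lt (Or.inl hs0) (Or.inl ENNReal.ofReal_ne_top)] at h
  have h2 := h.trans_le h1
  rw [ENNReal.ofReal, ← ENNReal.coe_mul, ENNReal.coe_lt_coe, ← NNReal.coe_lt_coe] at h2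
  push_cast at h2
  rw [Real.coe_toNNReal _ hs.le] at h2
  rwa [← div_eq_mul_inv, lt_div_iff₀ hs]

variable {V : (n : ℕ) → Fin n → NodeFeatures r} {Θ : Set (Param m)} {θ₀ : Param m}
  {I₀ : Matrix (ParamIdx m) (ParamIdx m) ℝ} {Ω : ℕ → Type*} [∀ n, MeasurableSpace (Ω n)]
  {P : (n : ℕ) → Measure (Ω n)} [∀ n, IsProbabilityMeasure (P n)]
  {X : (n : ℕ) → Ω n → Network n} {lam : ℕ → ℝ≥0} {w : (n : ℕ) → Ω n → ParamIdx m → ℝ≥0}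
  {θhat : (n : ℕ) → Ω n → Param m}

/-- With probability tending to one, the estimator vanishes off the support of `θ₀`, and its scaled
error is as close as desired to the minimizer of the limiting quadratic problem on the support. -/
theorem tendsto_measure_not_sparse_and_close (hθ₀ : θ₀ ∈ interior Θ)
    (hI : InformationCondition F V θ₀ I₀) (hT : ThirdDerivativeCondition F V θ₀)
    (hX : ∀ n, Measurable (X n))
    (hlaw : ∀ n, ∀ x : Network n, (P n).real (X n ⁻¹' {x}) = networkProb F (V n) θ₀ x)
    (hmin : ∀ n, ∀ᵐ ω ∂(P n), θhat n ω ∈ Θ ∧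
      IsMinOn (objective F (V n) (lam n) (w n ω) (X n ω)) Θ (θhat n ω))
    (ha : TendstoZeroInProb P fun n ω =>
      maxPenalty θ₀ (lam n) (w n ω) / ENNReal.ofReal (Real.sqrt (numDyads n)))
    (hb : TendstoTopInProb P fun n ω =>
      minPenalty θ₀ (lam n) (w n ω) / ENNReal.ofReal (Real.sqrt (numDyads n)))
    {η : ℝ} (hη : 0 < η) :
    Tendsto (fun n => P n {ω | ¬ ((∀ k ∈ (support θ₀)ᶜ, θhat n ω k = 0) ∧
      ‖Real.sqrt (numDyads n) • (θhat n ω - θ₀) -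
        supportedMin I₀ (support θ₀) (observedScore F V θ₀ X n ω)‖ ≤ η)}) atTop (𝓝 0) := by
  rw [ENNReal.tendsto_nhds_zero]
  intro δ hδ
  have hδ2 : 0 < δ / 2 := ENNReal.half_pos hδ.ne'
  have hδ4 : 0 < δ / 2 / 2 := ENNReal.half_pos hδ2.ne'
  obtain ⟨R₁, hR₁, hscore⟩ := exists_measure_norm_observedScore_gt_le F hI hT hX hlaw hδ2
  obtain ⟨α, hα, L, hL, R, hR, ε, hε, hdet⟩ := exists_minimizer_bounds hI.2 hR₁ hη
  lift α to ℝ≥0 using hα.le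
  lift L to ℝ≥0 using hL
  obtain ⟨ρ, hρ, hball⟩ := Metric.mem_nhds_iff.1 (mem_interior_iff_mem_nhds.1 hθ₀)
  have hrR : Tendsto (fun n => rate n * R) atTop (𝓝 0) := by
    simpa using tendsto_rate.mul_const R
  filter_upwards [eventually_rate, hrR.eventually_lt_const hρ,
    eventually_abs_centredPot_sub_le F V θ₀ I₀ hI.1 hT (2 * R) hε,
    (ENNReal.tendsto_nhds_zero.1 (ha α (by exact_mod_cast hα))) _ hδ4,
    (ENNReal.tendsto_nhds_zero.1 (hb L)) _ hδ4] with n ⟨hn1, _⟩ hn2 hn3 hn4 hn5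
  set s : ℝ := Real.sqrt (numDyads n)
  have hs : 0 < s := inv_pos.1 hn1
  have hrs : rate n = s⁻¹ := rfl
  set E₁ : Set (Ω n) := {ω | R₁ < ‖observedScore F V θ₀ X n ω‖}
  set E₂ : Set (Ω n) := {ω | (α : ℝ≥0∞) ≤
    maxPenalty θ₀ (lam n) (w n ω) / ENNReal.ofReal s}
  set E₃ : Set (Ω n) := {ω | minPenalty θ₀ (lam n) (w n ω) / ENNReal.ofReal s ≤
    (L : ℝ≥0∞)}
  set E₄ : Set (Ω n) := {ω | ¬ (θhat n ω ∈ Θ ∧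
      IsMinOn (objective F (V n) (lam n) (w n ω) (X n ω)) Θ (θhat n ω))}
  refine (measure_mono (t := E₁ ∪ (E₂ ∪ E₃) ∪ E₄) fun ω hω => ?_).trans ?_
  · by_contra hcon
    simp only [Set.mem_union, not_or] at hcon
    obtain ⟨⟨h1, h2, h3⟩, h4⟩ := hcon
    obtain ⟨-, hopt⟩ := not_not.1 h4
    refine hω ?_
    set u : Param m := s • (θhat n ω - θ₀) with hu
    have hθ : θhat n ω = θ₀ + rate n • u := by
      rw [hu, hrs, smul_smul, inv_mul_cancel₀ hs.ne', one_smul, add_sub_cancel]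
    have hres := hdet (observedScore F V θ₀ X n ω) (centredPot F (V n) θ₀ (rate n))
      (fun k => (lam n : ℝ) * w n ω k) θ₀ (rate n) u (convexOn_centredPot F (V n) θ₀ (rate n))
      (centredPot_zero F (V n) θ₀ (rate n)) hn3 (not_lt.1 h1) (fun k => by positivity) hn1
      (penalty_mul_inv_le_of_maxPenalty hs h2) (lt_penalty_mul_inv_of_minPenalty hs h3)
      fun v hv => by
        have hv' : θ₀ + rate n • v ∈ Θ := by
          refine hball ?_
          rw [Metric.mem_ball, dist_eq_norm, add_sub_cancel_left, norm_smul,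
            Real.norm_of_nonneg hn1.le]
          exact lt_of_le_of_lt (by gcongr) hn2
        have h5 := isMinOn_iff.1 hopt _ hv'
        rw [hθ] at h5
        rw [observedScore, ← objective_sub, ← objective_sub]
        linarith
    refine ⟨fun k hk => ?_, hres.2⟩
    have hk0 : θ₀ k = 0 := by simpa [support] using hk
    have := hres.1 k hk0
    rw [hθ]
    simp [this, hk0]
  · have h4 : P n E₄ = 0 := hmin n
    calc P n (E₁ ∪ (E₂ ∪ E₃) ∪ E₄) ≤ P n E₁ + (P n E₂ + P n E₃) + P n E₄ := by
          refine (measure_union_le _ _).trans ?_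
          gcongr
          refine (measure_union_le _ _).trans ?_
          gcongr
          exact measure_union_le _ _
      _ ≤ δ / 2 + (δ / 2 / 2 + δ / 2 / 2) + 0 := by
          rw [h4]; gcongr; exact hscore n
      _ = δ := by rw [ENNReal.add_halves, add_zero, ENNReal.add_halves]

end Estimator

lemma measurable_restrict {m : ℕ} (A : Set (ParamIdx m)) : Measurable (restrict A) := by
  unfold restrict
  fun_prop

open scoped Classical in
lemma inner_restrict {m : ℕ} (A : Set (ParamIdx m)) (x : Param m) (t : EuclideanSpace ℝ A) :
    inner ℝ (restrict A x) t = inner ℝ x (extendZero A t.ofLp) := by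
  have := sum_extendZero_mul A t.ofLp x.ofLp
  rw [PiLp.inner_apply, PiLp.inner_apply]
  simpa [restrict] using this.symm

/-- `supportedMin` is a self-adjoint function of `Z`, so linear functionals of it are linear
functionals of the score. -/
lemma inner_supportedMin_comm {m : ℕ} {S : Matrix (ParamIdx m) (ParamIdx m) ℝ} (hS : S.PosDef)
    (A : Set (ParamIdx m)) (x y : Param m) :
    inner ℝ (supportedMin S A x) y = inner ℝ (supportedMin S A y) x := by
  have hT : Sᵀ = S := by simpa using hS.isHermitian.eq
  rw [dotProduct_mulVec_supportedMin hS A y _ fun k hk => supportedMin_apply_eq_zero S A x hk,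
    dotProduct_mulVec_supportedMin hS A x _ fun k hk => supportedMin_apply_eq_zero S A y hk,
    Matrix.dotProduct_mulVec, ← Matrix.mulVec_transpose, dotProduct_comm, hT]

open scoped Classical in
/-- The asymptotic variance of `tᵀ √N (θhat - θ₀)` on the support. -/
lemma dotProduct_supportedMin_extendZero {m : ℕ} {S : Matrix (ParamIdx m) (ParamIdx m) ℝ}
    (hS : S.PosDef) (A : Set (ParamIdx m)) (t : EuclideanSpace ℝ A) :
    (supportedMin S A (extendZero A t.ofLp)).ofLp ⬝ᵥ
        S *ᵥ (supportedMin S A (extendZero A t.ofLp)).ofLp =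
      t.ofLp ⬝ᵥ (S.submatrix (fun k : A => (k : ParamIdx m))
        (fun k : A => (k : ParamIdx m)))⁻¹ *ᵥ t.ofLp := by
  rw [← dotProduct_mulVec_supportedMin hS A _ _ fun k hk => supportedMin_apply_eq_zero S A _ hk,
    ← inner_restrict, PiLp.inner_apply, dotProduct]
  refine Finset.sum_congr rfl fun a _ => ?_
  simp [restrict, supportedMin, extendZero]

end DirectedNetwork

open DirectedNetwork in
open scoped Classical in
theorem theorem2 {m : ℕ} {r : Fin m → ℕ} (F : FeatureMaps r)
    -- the nodal features of the `n`-th network, fixed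
    (V : (n : ℕ) → Fin n → NodeFeatures r)
    -- the parameter space and the true parameter
    (Θ : Set (Param m)) (θ₀ : Param m) (hθ₀ : θ₀ ∈ interior Θ)
    -- regularity conditions
    (I₀ : Matrix (ParamIdx m) (ParamIdx m) ℝ) (hI : InformationCondition F V θ₀ I₀)
    (hT : ThirdDerivativeCondition F V θ₀)
    -- the observed networks, drawn from the model with parameter `θ₀`
    {Ω : ℕ → Type*} [∀ n, MeasurableSpace (Ω n)] (P : (n : ℕ) → Measure (Ω n))
    [∀ n, IsProbabilityMeasure (P n)]
    (X : (n : ℕ) → Ω n → Network n) (hX : ∀ n, Measurable (X n))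
    (hlaw : ∀ n, ∀ x : Network n, (P n).real (X n ⁻¹' {x}) = networkProb F (V n) θ₀ x)
    -- the tuning parameters and the (possibly random, data-dependent) weights
    (lam : ℕ → ℝ≥0) (w : (n : ℕ) → Ω n → ParamIdx m → ℝ≥0) (hw : ∀ n, Measurable (w n))
    -- the regularized maximum likelihood estimators
    (θhat : (n : ℕ) → Ω n → Param m) (hmeas : ∀ n, AEMeasurable (θhat n) (P n))
    (hmin : ∀ n, ∀ᵐ ω ∂(P n), θhat n ω ∈ Θ ∧
      IsMinOn (objective F (V n) (lam n) (w n ω) (X n ω)) Θ (θhat n ω))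
    -- the penalty on the nonzero coefficients is small
    (ha : TendstoZeroInProb P fun n ω =>
      maxPenalty θ₀ (lam n) (w n ω) / ENNReal.ofReal (Real.sqrt (numDyads n)))
    -- the penalty on the zero coefficients is large
    (hb : TendstoTopInProb P fun n ω =>
      minPenalty θ₀ (lam n) (w n ω) / ENNReal.ofReal (Real.sqrt (numDyads n))) :
    -- selection consistency
    Tendsto (fun n => P n {ω | ∀ k ∈ (support θ₀)ᶜ, θhat n ω k = 0}) atTop (𝓝 1) ∧
    -- asymptotic normality
    TendstoInDistribution
      (fun n ω => Real.sqrt (numDyads n) •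
        (restrict (support θ₀) (θhat n ω) - restrict (support θ₀) θ₀))
      atTop id P
      (multivariateGaussian (0 : EuclideanSpace ℝ (support θ₀))
        (I₀.submatrix (fun k : support θ₀ => (k : ParamIdx m))
          (fun k : support θ₀ => (k : ParamIdx m)))⁻¹) := by
  have hbad := fun {η : ℝ} (hη : 0 < η) =>
    tendsto_measure_not_sparse_and_close F hθ₀ hI hT hX hlaw hmin ha hb hη
  refine ⟨?_, ?_⟩
  · -- Only outer measure is needed: a set and its complement have total measure at least `1`.
    have h1 : Tendsto (fun n => 1 - P n {ω | ¬ ((∀ k ∈ (support θ₀)ᶜ, θhat n ω k = 0) ∧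
        ‖Real.sqrt (numDyads n) • (θhat n ω - θ₀) -
          supportedMin I₀ (support θ₀) (observedScore F V θ₀ X n ω)‖ ≤ 1)}) atTop (𝓝 (1 - 0)) :=
      ENNReal.Tendsto.sub tendsto_const_nhds (hbad one_pos) (Or.inl ENNReal.one_ne_top)
    rw [tsub_zero] at h1
    refine tendsto_of_tendsto_of_tendsto_of_le_of_le h1 tendsto_const_nhds (fun n => ?_)
      fun n => prob_le_one
    rw [tsub_le_iff_right, ← measure_univ (μ := P n)]
    refine (measure_mono fun ω _ => ?_).trans (measure_union_le _ _)
    by_cases h : ∀ k ∈ (support θ₀)ᶜ, θhat n ω k = 0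
    · exact Or.inl h
    · exact Or.inr fun h' => h h'.1
  · have hYeq : ∀ n ω, Real.sqrt (numDyads n) •
        (restrict (support θ₀) (θhat n ω) - restrict (support θ₀) θ₀) =
        restrict (support θ₀) (Real.sqrt (numDyads n) • (θhat n ω - θ₀)) := fun n ω => by
      ext k; simp [restrict]
    have hYm : ∀ n, AEMeasurable (fun ω => Real.sqrt (numDyads n) •
        (restrict (support θ₀) (θhat n ω) - restrict (support θ₀) θ₀)) (P n) := fun n =>
      AEMeasurable.fun_const_smul (AEMeasurable.sub_const
        ((measurable_restrict (support θ₀)).comp_aemeasurable (hmeas n)) _) _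
    refine ⟨hYm, aemeasurable_id, ?_⟩
    refine ProbabilityMeasure.tendsto_of_tendsto_charFun fun t => ?_
    simp only [ProbabilityMeasure.coe_mk, Measure.map_id]
    have hpos : ((I₀.submatrix (fun k : support θ₀ => (k : ParamIdx m))
          (fun k : support θ₀ => (k : ParamIdx m)))⁻¹).PosSemidef :=
      (hI.2.submatrix Subtype.val_injective).inv.posSemidef
    rw [charFun_multivariateGaussian hpos, ← dotProduct_supportedMin_extendZero hI.2]
    set v := supportedMin I₀ (support θ₀) (extendZero (support θ₀) t.ofLp) with hv
    have hZ := tendsto_integral_exp_inner_observedScore F hI hT hX hlaw v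
    have hW : ∀ n ω, inner ℝ v (observedScore F V θ₀ X n ω) =
        inner ℝ (supportedMin I₀ (support θ₀) (observedScore F V θ₀ X n ω))
          (extendZero (support θ₀) t.ofLp) := fun n ω => inner_supportedMin_comm hI.2 _ _ _
    have hlim := tendsto_integral_exp_of_sub_tendsto (P := P)
      (Y := fun n ω => inner ℝ (Real.sqrt (numDyads n) •
        (restrict (support θ₀) (θhat n ω) - restrict (support θ₀) θ₀)) t)
      (W := fun n ω => inner ℝ v (observedScore F V θ₀ X n ω))
      (fun n => (hYm n).inner_const)
      (fun n => ((measurable_observedScore F hX n).const_inner).aemeasurable) ?_ hZ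
    · convert hlim using 2 with n
      · rw [charFun_apply, integral_map (hYm n)
          (Continuous.aestronglyMeasurable (by fun_prop))]
      · rw [inner_zero_right, Complex.ofReal_zero, zero_mul, zero_sub, neg_div]
    · intro ε hε
      set B : ℝ := ‖extendZero (support θ₀) t.ofLp‖
      have hB : 0 ≤ B := norm_nonneg _
      have hη : 0 < ε / (B + 1) := by positivity
      refine tendsto_of_tendsto_of_tendsto_of_le_of_le tendsto_const_nhds (hbad hη)
        (fun _ => zero_le) fun n => measure_mono fun ω hω hcon => ?_
      have hω' : ε < |inner ℝ (Real.sqrt (numDyads n) •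
        (restrict (support θ₀) (θhat n ω) - restrict (support θ₀) θ₀)) t -
          inner ℝ v (observedScore F V θ₀ X n ω)| := hω
      rw [hYeq, inner_restrict, hW, ← inner_sub_left] at hω'
      have h1 := abs_real_inner_le_norm (Real.sqrt (numDyads n) • (θhat n ω - θ₀) -
        supportedMin I₀ (support θ₀) (observedScore F V θ₀ X n ω)) (extendZero (support θ₀) t.ofLp)
      have h2 : ε / (B + 1) * B ≤ ε := by
        rw [div_mul_eq_mul_div, div_le_iff₀ (by positivity)]
        nlinarith
      have h3 := mul_le_mul_of_nonneg_right hcon.2 hB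
      linarith
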